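/- Let $n,k\ge 0$ be integers with $2k\le n$ and let $\mu=(n-k,k)$, a partition of $n$ with at most two rows. The symmetric group $S_n$ acts on $\mathbb{Q}[x_1,\dots,x_n]$ by permuting the variables. **The module $R_\mu$.** For $A\subseteq\{1,\dots,n\}$ let $e_r(A)$ be the $r$-th elementary symmetric polynomial in the variables $x_i$, $i\in A$. Put $c_t(\mu)=\mu'_1+\cdots+\mu'_t-t$, where $\mu'$ is the conjugate partition. The Garsia–Procesi module is $R_\mu=\mathbb{Q}[x_1,\dots,x_n]/I_\mu$ with $I_\mu=\langle e_r(A) : c_{n-|A|}(\mu)<r\le |A|\rangle$, with the induced action of $S_n$. **Cocharge labels.** Tableaux are drawn in the French convention (first row at the bottom), and the reading word of a tableau lists its rows from top to bottom, each from left to right. Let $w$ be a word whose content is a partition. Its first standard subword starts at the rightmost $1$ of $w$; after a letter $j$ has been chosen, the next letter chosen is the rightmost $j+1$ to the left of it if there is one, and the rightmost $j+1$ of $w$ otherwise, until there is no letter $j+1$. Remove this subword and repeat, which decomposes $w$ into standard subwords. In each subword the letter $1$ gets label $0$, and $j+1$ gets the label of $j$ if it stands to the right of $j$, and that label plus $1$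 if it stands to the left of $j$. For a semistandard Young tableau $S$ of content $\mu$ and a square $s$, let $\mathrm{cw}_S(s)$ be the label of the letter of the reading word of $S$ at $s$. **The polynomials.** Let $\lambda\vdash n$, let $S$ be a semistandard Young tableau of shape $\lambda$ and content $\mu$, and let $T$ be a standard Young tableau of shape $\lambda$. Let $R(T),C(T)\subseteq S_n$ be the groups of permutations that preserve the rows, respectively the columns, of $T$. The semistandard higher Specht polynomial is $$F_T^S=\sum_{\tau\in C(T)}\sum_{\sigma\in R(T)}\mathrm{sgn}(\tau)\,\tau\sigma\cdot\prod_{s\in\lambda}x_{T(s)}^{\mathrm{cw}_S(s)} .$$ **Higher Specht bases.** Let $V_\lambda$ be the Specht module of $\lambda\vdash n$, that is, the span in $\mathbb{Q}[x_1,\dots,x_n]$ of the Specht polynomials $\prod (x_{T(s')}-x_{T(s)})$ (product over pairs of squares $s,s'$ in the same column with $s'$ above $s$) of all bijective fillings $T$ of $\lambda$ by $1,\dots,n$. A subset $\mathcal{B}$ of an $S_n$-module $R$ is a higher Specht basis of $R$ if there are multiplicities $c_\lambda$, a decomposition of $R$ as an internal direct sum of submodules $V_{\lambda,i}\cong V_\lambda$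 ($\lambda\vdash n$, $1\le i\le c_\lambda$), and a decomposition $\mathcal{B}=\bigcup_\lambda\bigcup_{i=1}^{c_\lambda}\mathcal{B}_{\lambda,i}$ such that each $\mathcal{B}_{\lambda,i}$ is a basis of $V_{\lambda,i}$. **Theorem.** The set $$\mathcal{B}_\mu=\Big\{F_T^S : (S,T)\in\bigcup_{\lambda\vdash n}\mathrm{SSYT}(\lambda,\mu)\times\mathrm{SYT}(\lambda)\Big\}$$ descends to a higher Specht basis of $R_\mu$: the images in $R_\mu$ of the $F_T^S$ for different pairs $(S,T)$ are different, and the set of these images is a higher Specht basis of $R_\mu$. -/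

import Mathlib

open MvPolynomial

noncomputable section

/-! ### Cocharge words

A word is a function `w : α → ℕ` on a linearly ordered set of positions, together with the finite
set `A` of the positions that are in use (read in increasing order). -/

section Cocharge

variable {α : Type*} [LinearOrder α]

/-- The position of the letter `k` cyclically previous to the position `p`: the rightmost `k` to
the left of `p` if there is one, the rightmost `k` in the word otherwise (`⊥` if the word has no
letter `k`). -/
def cprev (w : α → ℕ) (A : Finset α) (k : ℕ) (p : WithBot α) : WithBot α :=
  if (A.filter fun q => w q = k ∧ (q : WithBot α) < p).Nonempty then
    (A.filter fun q => w q = k ∧ (q : WithBot α) < p).max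
  else (A.filter fun q => w q = k).max

/-- The position of the letter `k` in the first standard subword (`⊥` if that subword has no
letter `k`). It starts at the rightmost `1`; the letter `k + 1` is the one that is cyclically
previous to the chosen letter `k`. -/
def stdPos (w : α → ℕ) (A : Finset α) : ℕ → WithBot α
  | 0 => ⊥
  | 1 => (A.filter fun q => w q = 1).max
  | k + 2 => cprev w A (k + 2) (stdPos w A (k + 1))

/-- The set of positions of the first standard subword. -/
def firstStandardSubword (w : α → ℕ) (A : Finset α) : Finset α :=
  A.filter fun p => stdPos w A (w p) = (p : WithBot α)

/-- The cocharge label of the letter `k` in the first standard subword: `1` has label `0`, and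
`k + 1` has the label of `k` if it stands to the right of `k`, and that label plus one if it
stands to the left of `k`. -/
def stdLabel (w : α → ℕ) (A : Finset α) : ℕ → ℕ
  | 0 => 0
  | 1 => 0
  | k + 2 =>
    if stdPos w A (k + 1) < stdPos w A (k + 2) then stdLabel w A (k + 1)
    else stdLabel w A (k + 1) + 1

/-- The cocharge labels given by the first `m` subwords of the standard subword decomposition,
each of them being the first standard subword of what the previous ones leave. -/
def cwAux (w : α → ℕ) : ℕ → Finset α → α → ℕ
  | 0, _, _ => 0
  | m + 1, A, p =>
    if p ∈ firstStandardSubword w A then stdLabel w A (w p)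
    else cwAux w m (A \ firstStandardSubword w A) p

/-- The cocharge word: the label of each position. The number of standard subwords is the number
of letters `1`. -/
def cochargeWord (w : α → ℕ) (A : Finset α) (p : α) : ℕ :=
  cwAux w (A.filter fun q => w q = 1).card A p

end Cocharge

/-! ### Tableaux

Partitions are Young diagrams; the square `(i, j)` lies in row `i` and column `j`, and row `0` is
the bottom row in the French convention. -/

/-- Partitions of `n`. -/
abbrev Shape (n : ℕ) : Type := {ν : YoungDiagram // ν.card = n}

/-- The partition `(n - k, k)`. -/
def twoRow (n k : ℕ) (h : 2 * k ≤ n) : YoungDiagram :=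
  YoungDiagram.ofRowLens [n - k, k] (by
    simp [List.sortedGE_iff_pairwise]; omega)

/-- The tableau `S` has positive entries and content `μ`: for each `i`, the letter `i + 1` occurs
as often as the length of row `i` of `μ`. -/
def HasContent {ν : YoungDiagram} (S : SemistandardYoungTableau ν) (μ : YoungDiagram) : Prop :=
  (∀ c ∈ ν.cells, 0 < S c.1 c.2) ∧
    ∀ i, (ν.cells.filter fun c => S c.1 c.2 = i + 1).card = μ.rowLen i

/-- `SSYT(ν, μ)`. -/
abbrev SSYT (ν μ : YoungDiagram) : Type :=
  {S : SemistandardYoungTableau ν // HasContent S μ}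

/-- `Tab(ν)`: the bijective fillings of `ν`, by the indices of the variables. -/
abbrev Tab (n : ℕ) (ν : YoungDiagram) : Type := ν.cells ≃ Fin n

/-- Standard tableaux: entries increase along rows and up columns. -/
def IsStandard {n : ℕ} {ν : YoungDiagram} (T : Tab n ν) : Prop :=
  (∀ c d : ν.cells, c.1.1 = d.1.1 → c.1.2 < d.1.2 → T c < T d) ∧
    ∀ c d : ν.cells, c.1.2 = d.1.2 → c.1.1 < d.1.1 → T c < T d

/-- `SYT(ν)`. -/
abbrev SYT (n : ℕ) (ν : YoungDiagram) : Type := {T : Tab n ν // IsStandard T}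

/-- The reading order on squares: rows from top to bottom, each row from left to right. -/
abbrev ReadPos : Type := ℕᵒᵈ ×ₗ ℕ

/-- The place of a square in the reading order. -/
def readPos (c : ℕ × ℕ) : ReadPos := toLex (OrderDual.toDual c.1, c.2)

/-- The square at a place of the reading order. -/
def square (p : ReadPos) : ℕ × ℕ := (OrderDual.ofDual (ofLex p).1, (ofLex p).2)

/-- The cocharge label of the square `c` of `S`, taken from the reading word of `S`. -/
def cwTableau {ν : YoungDiagram} (S : SemistandardYoungTableau ν) (c : ℕ × ℕ) : ℕ :=
  cochargeWord (fun p : ReadPos => S (square p).1 (square p).2) (ν.cells.image readPos)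
    (readPos c)

/-! ### Higher Specht polynomials -/

/-- `S_n` acts on `ℚ[x_1, …, x_n]` by permuting the variables. -/
def polyRep (n : ℕ) : Representation ℚ (Equiv.Perm (Fin n)) (MvPolynomial (Fin n) ℚ) where
  toFun σ := (rename σ : MvPolynomial (Fin n) ℚ →ₐ[ℚ] MvPolynomial (Fin n) ℚ).toLinearMap
  map_one' := by
    refine LinearMap.ext fun p => ?_
    simp
  map_mul' σ τ := by
    refine LinearMap.ext fun p => ?_
    simp only [Module.End.mul_apply, AlgHom.toLinearMap_apply, rename_rename, Equiv.Perm.coe_mul]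

open Classical in
/-- The group `R(T)` of row permutations, as a finite set. -/
def rowGroup {n : ℕ} {ν : YoungDiagram} (T : Tab n ν) : Finset (Equiv.Perm (Fin n)) :=
  Finset.univ.filter fun σ => ∀ m, (T.symm (σ m)).1.1 = (T.symm m).1.1

open Classical in
/-- The group `C(T)` of column permutations, as a finite set. -/
def colGroup {n : ℕ} {ν : YoungDiagram} (T : Tab n ν) : Finset (Equiv.Perm (Fin n)) :=
  Finset.univ.filter fun τ => ∀ m, (T.symm (τ m)).1.2 = (T.symm m).1.2

/-- The Young symmetrizer `ε_T = ∑_{τ ∈ C(T)} ∑_{σ ∈ R(T)} sgn(τ) τ σ` in `ℚ[S_n]`. -/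
def youngSymmetrizer {n : ℕ} {ν : YoungDiagram} (T : Tab n ν) :
    MonoidAlgebra ℚ (Equiv.Perm (Fin n)) :=
  ∑ τ ∈ colGroup T, ∑ σ ∈ rowGroup T,
    MonoidAlgebra.single (τ * σ) (((Equiv.Perm.sign τ : ℤˣ) : ℤ) : ℚ)

/-- The semistandard higher Specht polynomial `F_T^S = ε_T · ∏_c x_{T(c)}^{cw_S(c)}`. -/
def higherSpecht {n : ℕ} {ν : YoungDiagram} (S : SemistandardYoungTableau ν) (T : Tab n ν) :
    MvPolynomial (Fin n) ℚ :=
  (polyRep n).asAlgebraHom (youngSymmetrizer T) (∏ c : ν.cells, X (T c) ^ cwTableau S c.1)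

/-! ### Specht modules and higher Specht bases -/

/-- The ordinary Specht polynomial of `T`: the product, over all pairs of squares in the same
column, of the variable of the upper square minus the variable of the lower square. -/
def spechtPoly {n : ℕ} {ν : YoungDiagram} (T : Tab n ν) : MvPolynomial (Fin n) ℚ :=
  ∏ p : ν.cells × ν.cells,
    if p.1.1.2 = p.2.1.2 ∧ p.1.1.1 < p.2.1.1 then X (T p.2) - X (T p.1) else 1

theorem polyRep_spechtPoly {n : ℕ} {ν : YoungDiagram} (σ : Equiv.Perm (Fin n)) (T : Tab n ν) :
    polyRep n σ (spechtPoly T) = spechtPoly (T.trans σ) := by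
  simp only [polyRep, spechtPoly, MonoidHom.coe_mk, OneHom.coe_mk, AlgHom.toLinearMap_apply,
    map_prod]
  refine Finset.prod_congr rfl fun p _ => ?_
  split_ifs <;> simp

/-- The Specht module: the span of the Specht polynomials of all fillings of `ν`, as a
subrepresentation of the polynomial ring. -/
def spechtModule (n : ℕ) (ν : YoungDiagram) : Subrepresentation (polyRep n) where
  toSubmodule := Submodule.span ℚ (Set.range fun T : Tab n ν => spechtPoly T)
  apply_mem_toSubmodule σ v hv := by
    induction hv using Submodule.span_induction with
    | mem x hx =>
      obtain ⟨T, rfl⟩ := hx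
      simp only [polyRep_spechtPoly]
      exact Submodule.subset_span ⟨T.trans σ, rfl⟩
    | zero => simp
    | add x y _ _ hx hy => rw [map_add]; exact Submodule.add_mem _ hx hy
    | smul a x _ hx => rw [map_smul]; exact Submodule.smul_mem _ a hx

/-- `B` is a higher Specht basis of the `S_n`-module `ρ`: there are a decomposition of the module
as an internal direct sum of subrepresentations `V ⟨ν, i⟩`, for `ν ⊢ n` and `i < c ν`, with
`V ⟨ν, i⟩` isomorphic to the Specht module of `ν`, and a decomposition of `B` as the union of sets
`P ⟨ν, i⟩`, each of which is a basis of `V ⟨ν, i⟩`. -/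
def IsHigherSpechtBasis {n : ℕ} {M : Type*} [AddCommGroup M] [Module ℚ M]
    (ρ : Representation ℚ (Equiv.Perm (Fin n)) M) (B : Set M) : Prop :=
  ∃ (c : Shape n → ℕ) (V : (Σ ν : Shape n, Fin (c ν)) → Subrepresentation ρ)
    (P : (Σ ν : Shape n, Fin (c ν)) → Set M),
    iSupIndep (fun i => (V i).toSubmodule) ∧
    (⨆ i, (V i).toSubmodule) = ⊤ ∧
    (∀ i, Nonempty ((V i).toRepresentation.Equiv (spechtModule n i.1.1).toRepresentation)) ∧
    B = ⋃ i, P i ∧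
    ∀ i, LinearIndepOn ℚ id (P i) ∧ Submodule.span ℚ (P i) = (V i).toSubmodule

/-! ### Garsia–Procesi modules -/

/-- The partial elementary symmetric polynomial `e_r(A)` in the variables with index in `A`. -/
def partialEsymm {n : ℕ} (A : Finset (Fin n)) (r : ℕ) : MvPolynomial (Fin n) ℚ :=
  ∑ B ∈ A.powersetCard r, ∏ i ∈ B, X i

/-- `c_t(μ) = μ'_1 + ⋯ + μ'_t - t`. -/
def colExcess (μ : YoungDiagram) (t : ℕ) : ℤ :=
  (∑ j ∈ Finset.range t, (μ.colLen j : ℤ)) - t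

/-- The ideal `I_μ`, generated by the `e_r(A)` with `c_{n-|A|}(μ) < r ≤ |A|`. -/
def tanisakiIdeal (n : ℕ) (μ : YoungDiagram) : Ideal (MvPolynomial (Fin n) ℚ) :=
  Ideal.span {p | ∃ (A : Finset (Fin n)) (r : ℕ),
    colExcess μ (n - A.card) < r ∧ r ≤ A.card ∧ p = partialEsymm A r}

theorem rename_partialEsymm {n : ℕ} (σ : Equiv.Perm (Fin n)) (A : Finset (Fin n)) (r : ℕ) :
    rename σ (partialEsymm A r) = partialEsymm (A.map σ.toEmbedding) r := by
  simp only [partialEsymm, map_sum, map_prod, rename_X, Finset.powersetCard_map, Finset.sum_map]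
  refine Finset.sum_congr rfl fun B _ => ?_
  simp [Finset.mapEmbedding_apply]

theorem tanisakiIdeal_le_comap (n : ℕ) (μ : YoungDiagram) (σ : Equiv.Perm (Fin n)) :
    tanisakiIdeal n μ ≤ (tanisakiIdeal n μ).comap
      (rename σ : MvPolynomial (Fin n) ℚ →ₐ[ℚ] MvPolynomial (Fin n) ℚ) := by
  refine Ideal.span_le.2 ?_
  rintro p ⟨A, r, h1, h2, rfl⟩
  refine Ideal.subset_span ⟨A.map σ.toEmbedding, r, ?_, ?_, ?_⟩
  · simpa using h1
  · simpa using h2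
  · exact rename_partialEsymm σ A r

/-- `R_μ = ℚ[x_1, …, x_n] / I_μ`. -/
abbrev GarsiaProcesi (n : ℕ) (μ : YoungDiagram) : Type :=
  MvPolynomial (Fin n) ℚ ⧸ tanisakiIdeal n μ

/-- The action of `S_n` on `R_μ` induced by the permutations of the variables. -/
def garsiaProcesiRep (n : ℕ) (μ : YoungDiagram) :
    Representation ℚ (Equiv.Perm (Fin n)) (GarsiaProcesi n μ) where
  toFun σ := (Ideal.quotientMapₐ (tanisakiIdeal n μ)
    (rename σ : MvPolynomial (Fin n) ℚ →ₐ[ℚ] MvPolynomial (Fin n) ℚ)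
    (tanisakiIdeal_le_comap n μ σ)).toLinearMap
  map_one' := by
    refine LinearMap.ext fun x => ?_
    obtain ⟨p, rfl⟩ := Ideal.Quotient.mk_surjective x
    simp [Ideal.quotientMapₐ]
  map_mul' σ τ := by
    refine LinearMap.ext fun x => ?_
    obtain ⟨p, rfl⟩ := Ideal.Quotient.mk_surjective x
    change Ideal.Quotient.mk (tanisakiIdeal n μ) (rename (σ * τ : Equiv.Perm (Fin n)) p) =
      Ideal.Quotient.mk (tanisakiIdeal n μ) (rename σ (rename τ p))
    rw [rename_rename, Equiv.Perm.coe_mul]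

/-- The index set of `𝓑_μ`: triples of a shape `ν ⊢ n`, some `S ∈ SSYT(ν, μ)` and some
`T ∈ SYT(ν)`. -/
abbrev TableauPair (n : ℕ) (μ : YoungDiagram) : Type :=
  Σ ν : Shape n, SSYT ν.1 μ × SYT n ν.1

/-- The class in `R_μ` of the polynomial `F_T^S` of a pair `(S, T)`. -/
def higherSpechtClass (n : ℕ) (μ : YoungDiagram) (q : TableauPair n μ) : GarsiaProcesi n μ :=
  Ideal.Quotient.mk (tanisakiIdeal n μ) (higherSpecht q.2.1.1 q.2.2.1)

end

/-! Content $(n-k,k)$ leaves little freedom. A semistandard tableau $S$ with this content has at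
most two rows, is determined by its shape, and has second row of length $j\le k$. Its reading word
is $2^j1^{n-k}2^{k-j}$, so the cocharge label of a square is its row index
(`HasContent.cwTableau_eq`). The monomial in $F_T^S$ is therefore the product of the second-row
variables. $R(T)$ fixes it, and antisymmetrizing over columns turns it into the Specht polynomial of
$T$, so $F_T^S$ is $|R(T)|$ times that polynomial (`higherSpecht_eq`). It remains to show that the
Specht polynomials of these standard $T$ give a basis of $R_\mu$ adapted to Specht modules.

Independence. Distinct pairs have distinct second rows, which give the leading monomials, so the
polynomials are independent before passing to the quotient. They lie in the space of multilinear
polynomials of degree at most $k$ killed by $\sum\partial_i$. Under the apolar pairing, which is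
positive definite, $I_\mu$ is orthogonal to this space (`tanisakiIdeal_le_apolarIdeal`). The two
thus meet only in $0$, and independence survives in $R_\mu$.

Spanning. In $R_\mu$ each $x_i^2$ and $\sum x_i$ vanish. A straightening argument reduces every
squarefree monomial to monomials of ballot sets (`prod_mem_of_not_isBallot`), and those of size
above $k$ are zero. Each remaining ballot set is the second row of a standard tableau, so $\dim
R_\mu$ is at most the number of pairs $(S,T)$, and the independent family spans
(`span_higherSpechtClass`).

Decomposition. The quotient map is injective on each relevant Specht module. Degree determines a
two-row shape, so the image of the Specht module of $\nu$ is the span of exactly the classes of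
shape $\nu$ (`map_spechtModule`). The standard basis of the Specht module is not presupposed; it
follows from the dimension count. -/

noncomputable section

/-! ### Rings generated by elements of square zero -/

section SquareZero

variable {ι R : Type*} [CommRing R]

/-- If the elements `x i` have square zero, then the `r`-th power of a sum of them is `r!` times
an elementary symmetric polynomial. -/
theorem sum_pow_of_mul_self_eq_zero [DecidableEq ι] (x : ι → R) (hx : ∀ i, x i * x i = 0)
    (S : Finset ι) (r : ℕ) :
    (∑ i ∈ S, x i) ^ r = (r.factorial : R) * ∑ B ∈ S.powersetCard r, ∏ i ∈ B, x i := by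
  induction S using Finset.induction_on generalizing r with
  | empty =>
    cases r with
    | zero => simp
    | succ r => rw [Finset.powersetCard_eq_empty.2 (by simp)]; simp
  | insert a S ha ih =>
    cases r with
    | zero => simp
    | succ r =>
      -- Since `x a` has square zero, only the first two terms of the binomial expansion survive.
      have key : ∀ s : R, (x a + s) ^ (r + 1) = s ^ (r + 1) + (r + 1) * s ^ r * x a := by
        intro s
        induction r with
        | zero => simp; ring
        | succ r ihr =>
          rw [pow_succ, ihr]
          push_cast
          linear_combination (r + 1) * s ^ r * hx a
      have hdisj : Disjoint (S.powersetCard (r + 1)) ((S.powersetCard r).image (insert a)) := by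
        rw [Finset.disjoint_left]
        intro B hB hB'
        obtain ⟨B', -, rfl⟩ := Finset.mem_image.1 hB'
        exact ha ((Finset.mem_powersetCard.1 hB).1 (Finset.mem_insert_self _ _))
      have hinj : Set.InjOn (insert a) (S.powersetCard r : Set (Finset ι)) := by
        intro B hB B' hB' h
        have h1 : a ∉ B := fun h => ha ((Finset.mem_powersetCard.1 hB).1 h)
        have h2 : a ∉ B' := fun h => ha ((Finset.mem_powersetCard.1 hB').1 h)
        rw [← Finset.erase_insert h1, ← Finset.erase_insert h2]
        exact congrArg (fun s => Finset.erase s a) h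
      rw [Finset.sum_insert ha, key, ih, ih, Finset.powersetCard_succ_insert ha,
        Finset.sum_union hdisj, Finset.sum_image hinj]
      have : ∑ B ∈ S.powersetCard r, ∏ i ∈ insert a B, x i =
          x a * ∑ B ∈ S.powersetCard r, ∏ i ∈ B, x i := by
        rw [Finset.mul_sum]
        refine Finset.sum_congr rfl fun B hB => ?_
        rw [Finset.prod_insert fun h => ha ((Finset.mem_powersetCard.1 hB).1 h)]
      rw [this, Nat.factorial_succ]
      push_cast
      ring

theorem factorial_mul_cancel [Algebra ℚ R] (r : ℕ) {a b : R}
    (h : (r.factorial : R) * a = (r.factorial : R) * b) : a = b := by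
  have h0 : (r.factorial : ℚ) ≠ 0 := by exact_mod_cast r.factorial_ne_zero
  have h1 : ((r.factorial : ℚ)⁻¹ • (1 : R)) * (r.factorial : R) = 1 := by
    rw [smul_mul_assoc, one_mul, show (r.factorial : R) = (r.factorial : ℚ) • (1 : R) by
      rw [← Algebra.algebraMap_eq_smul_one, map_natCast], smul_smul, inv_mul_cancel₀ h0, one_smul]
  calc a = ((r.factorial : ℚ)⁻¹ • (1 : R)) * (r.factorial : R) * a := by rw [h1, one_mul]
    _ = b := by rw [mul_assoc, h, ← mul_assoc, h1, one_mul]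

/-- Up to a sign, complementary sets have the same elementary symmetric polynomials, if the
variables have square zero and their sum is zero. -/
theorem esymm_compl_of_mul_self_eq_zero [Algebra ℚ R] [Fintype ι] [DecidableEq ι] (x : ι → R)
    (hx : ∀ i, x i * x i = 0) (h0 : ∑ i, x i = 0) (A : Finset ι) (r : ℕ) :
    ∑ B ∈ A.powersetCard r, ∏ i ∈ B, x i = (-1) ^ r * ∑ B ∈ Aᶜ.powersetCard r, ∏ i ∈ B, x i := by
  apply factorial_mul_cancel r
  rw [mul_left_comm, ← sum_pow_of_mul_self_eq_zero x hx, ← sum_pow_of_mul_self_eq_zero x hx,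
    ← mul_pow]
  congr 1
  rw [← Finset.sum_add_sum_compl A] at h0
  linear_combination h0

theorem prod_mul_prod_mem [DecidableEq ι] (x : ι → R) (hx : ∀ i, x i * x i = 0) (D E : Finset ι) :
    (∏ i ∈ D, x i) * ∏ i ∈ E, x i = 0 ∨
      (∏ i ∈ D, x i) * ∏ i ∈ E, x i = ∏ i ∈ D ∪ E, x i := by
  by_cases h : Disjoint D E
  · exact Or.inr (Finset.prod_union h).symm
  · obtain ⟨i, hi, hi'⟩ := Finset.not_disjoint_iff.1 h
    left
    rw [← Finset.mul_prod_erase _ _ hi, ← Finset.mul_prod_erase _ _ hi', mul_mul_mul_comm, hx,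
      zero_mul]

/-- A subalgebra generated by elements of square zero is spanned by squarefree monomials. -/
theorem adjoin_le_span_prod [Algebra ℚ R] [DecidableEq ι] (x : ι → R) (hx : ∀ i, x i * x i = 0)
    (S : Set ι) :
    Subalgebra.toSubmodule (Algebra.adjoin ℚ (x '' S)) ≤
      Submodule.span ℚ {p | ∃ D : Finset ι, (D : Set ι) ⊆ S ∧ p = ∏ i ∈ D, x i} := by
  rw [Algebra.adjoin_eq_span, Submodule.span_le]
  intro p hp
  have : p = 0 ∨ ∃ D : Finset ι, (D : Set ι) ⊆ S ∧ p = ∏ i ∈ D, x i := by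
    induction hp using Submonoid.closure_induction with
    | mem y hy =>
      obtain ⟨i, hi, rfl⟩ := hy
      exact Or.inr ⟨{i}, by simpa using hi, by simp⟩
    | one => exact Or.inr ⟨∅, by simp, by simp⟩
    | mul y z _ _ hy hz =>
      rcases hy with rfl | ⟨D, hD, rfl⟩
      · simp
      rcases hz with rfl | ⟨E, hE, rfl⟩
      · simp
      rcases prod_mul_prod_mem x hx D E with h | h
      · exact Or.inl h
      · exact Or.inr ⟨D ∪ E, by simp [hD, hE], h⟩
  rcases this with rfl | h
  · exact Submodule.zero_mem _
  · exact Submodule.subset_span h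

end SquareZero

/-! ### Ballot sets and straightening -/

/-- A set of indices is a ballot set if no initial segment contains more elements of the set than
of its complement. -/
def IsBallot {n : ℕ} (A : Finset (Fin n)) : Prop :=
  ∀ m : ℕ, (A.filter fun i => i.1 < m).card ≤ (Aᶜ.filter fun i => i.1 < m).card

section Straightening

variable {n : ℕ} {R : Type*} [CommRing R] [Algebra ℚ R] (x : Fin n → R)

/-- Choose an initial segment in which $A$ has more elements than its complement, and let $u$, $v$
be the sums of the variables in these two parts. With $r$ the size of the larger part, $u^r$ is $r!$
times its monomial and $v^r=0$. Hence $u^r=u^r-(-v)^r$ is divisible by $u+v$, which is minus the sum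
of the variables beyond the segment. Expanding replaces $A$ by sets that gain an element beyond the
segment and lose none there, so they are larger in colex order. -/
theorem prod_mem_of_not_isBallot (hx : ∀ i, x i * x i = 0) (h0 : ∑ i, x i = 0)
    (W : Submodule ℚ R) (A : Finset (Fin n)) (hA : ¬ IsBallot A)
    (hW : ∀ A', toColex A < toColex A' → ∏ i ∈ A', x i ∈ W) : ∏ i ∈ A, x i ∈ W := by
  simp only [IsBallot, not_forall, not_le] at hA
  obtain ⟨m, hm⟩ := hA
  set B := A.filter fun i => i.1 < m with hB
  set C := Aᶜ.filter fun i => i.1 < m with hC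
  set E := A.filter fun i => ¬ i.1 < m with hE
  set r := B.card with hr
  set u := ∑ i ∈ B, x i with hu
  set v := ∑ i ∈ C, x i with hv
  have hur : u ^ r = (r.factorial : R) * ∏ i ∈ B, x i := by
    rw [hu, sum_pow_of_mul_self_eq_zero x hx, hr, Finset.powersetCard_self]
    simp
  have hvr : v ^ r = 0 := by
    rw [hv, sum_pow_of_mul_self_eq_zero x hx, Finset.powersetCard_eq_empty.2 hm]
    simp
  set P := Algebra.adjoin ℚ (x '' {i | i.1 < m}) with hP
  have hmem : ∀ D : Finset (Fin n), (∀ i ∈ D, i.1 < m) → ∑ i ∈ D, x i ∈ P := fun D hD =>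
    Subalgebra.sum_mem _ fun i hi => Algebra.subset_adjoin ⟨i, hD i hi, rfl⟩
  have huP : u ∈ P := hmem _ fun i hi => (Finset.mem_filter.1 hi).2
  have hvP : v ∈ P := hmem _ fun i hi => (Finset.mem_filter.1 hi).2
  -- The cofactor is the geometric sum in $u$ and $-v$. It stays in the subalgebra `P` of the
  -- initial variables, so it cannot disturb the indices beyond the segment.
  obtain ⟨g, hgP, hg⟩ : ∃ g ∈ P, u ^ r = (u + v) * g := by
    refine ⟨∑ i ∈ Finset.range r, u ^ i * (-v) ^ (r - 1 - i), ?_, ?_⟩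
    · exact Subalgebra.sum_mem _ fun i _ =>
        Subalgebra.mul_mem _ (Subalgebra.pow_mem _ huP _)
          (Subalgebra.pow_mem _ (Subalgebra.neg_mem _ hvP) _)
    · have := (Commute.all u (-v)).mul_geom_sum₂ r
      rw [neg_pow v r, hvr, mul_zero, sub_zero, sub_neg_eq_add] at this
      exact this.symm
  have huv : u + v = -∑ y ∈ Finset.univ.filter (fun i : Fin n => ¬ i.1 < m), x y := by
    rw [eq_neg_iff_add_eq_zero, ← h0, ← Finset.sum_filter_add_sum_filter_not Finset.univ
      (fun i : Fin n => i.1 < m)]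
    congr 1
    rw [hu, hv, hB, hC, ← Finset.sum_union]
    · congr 1
      ext i
      simp only [Finset.mem_union, Finset.mem_filter, Finset.mem_compl, Finset.mem_univ, true_and]
      tauto
    · rw [Finset.disjoint_left]
      intro i hi hi'
      exact Finset.mem_compl.1 (Finset.mem_filter.1 hi').1 (Finset.mem_filter.1 hi).1
  have hterm : ∀ y : Fin n, ¬ y.1 < m → ∀ p ∈ P, x y * p * ∏ i ∈ E, x i ∈ W := by
    intro y hy p hp
    have hp' := adjoin_le_span_prod x hx _ hp
    clear hp
    induction hp' using Submodule.span_induction with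
    | mem q hq =>
      obtain ⟨D, hD, rfl⟩ := hq
      rw [mul_right_comm, mul_comm]
      by_cases hyE : y ∈ E
      · rw [← Finset.mul_prod_erase _ _ hyE, ← mul_assoc (x y), hx]
        simp
      · rw [← Finset.prod_insert hyE]
        rcases prod_mul_prod_mem x hx D (insert y E) with h | h
        · rw [h]
          exact W.zero_mem
        · rw [h]
          -- The new element `y` witnesses the increase: everything of `A` that was lost lies in the
          -- initial segment, below `y`.
          refine hW _ (Finset.Colex.toColex_lt_toColex_iff_exists_forall_lt.2 ⟨y, by simp, ?_, ?_⟩)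
          · exact fun hyA => hyE (Finset.mem_filter.2 ⟨hyA, hy⟩)
          · intro b hb hb'
            have hbm : b.1 < m := by
              by_contra hbm
              refine hb' (Finset.mem_union_right _ (Finset.mem_insert_of_mem ?_))
              exact Finset.mem_filter.2 ⟨hb, hbm⟩
            exact Fin.lt_def.2 (by omega)
    | zero => simp
    | add p q _ _ hp hq =>
      rw [mul_add, add_mul]
      exact W.add_mem hp hq
    | smul a p _ hp =>
      rw [mul_smul_comm, smul_mul_assoc]
      exact W.smul_mem _ hp
  have hfac : (r.factorial : R) * ∏ i ∈ A, x i ∈ W := by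
    rw [← Finset.prod_filter_mul_prod_filter_not A (fun i => i.1 < m), ← mul_assoc, ← hB, ← hur,
      hg, huv, neg_mul, neg_mul, Finset.sum_mul, Finset.sum_mul]
    exact W.neg_mem (W.sum_mem fun y hy => hterm y (Finset.mem_filter.1 hy).2 g hgP)
  have := W.smul_mem ((r.factorial : ℚ)⁻¹) hfac
  rwa [← nsmul_eq_mul, ← Nat.cast_smul_eq_nsmul ℚ, smul_smul,
    inv_mul_cancel₀ (by exact_mod_cast r.factorial_ne_zero), one_smul] at this

/-- A submodule that contains the squarefree monomials of ballot sets contains all squarefree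
monomials. -/
theorem prod_mem_of_isBallot (hx : ∀ i, x i * x i = 0) (h0 : ∑ i, x i = 0)
    (W : Submodule ℚ R) (hW : ∀ A, IsBallot A → ∏ i ∈ A, x i ∈ W)
    (A : Finset (Fin n)) : ∏ i ∈ A, x i ∈ W := by
  have : ∀ a : Colex (Finset (Fin n)), ∏ i ∈ ofColex a, x i ∈ W := by
    intro a
    have : Finite (Colex (Finset (Fin n))) := Finite.of_injective ofColex fun _ _ h => h
    induction a using WellFoundedGT.induction with
    | ind a ih =>
      by_cases ha : IsBallot (ofColex a)
      · exact hW _ ha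
      · exact prod_mem_of_not_isBallot x hx h0 W _ ha fun A' hA' => ih (toColex A') hA'
  exact this (toColex A)

end Straightening

/-! ### The ideal of a partition with two rows -/

section TwoRow

variable {n k : ℕ} (hk : 2 * k ≤ n)

theorem mem_twoRow {i j : ℕ} :
    (i, j) ∈ twoRow n k hk ↔ (i = 0 ∧ j < n - k) ∨ (i = 1 ∧ j < k) := by
  rw [twoRow, YoungDiagram.mem_ofRowLens]
  constructor
  · rintro ⟨h, h'⟩
    simp only [List.length_cons, List.length_nil] at h
    obtain rfl | rfl : i = 0 ∨ i = 1 := by omega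
    · exact Or.inl ⟨rfl, h'⟩
    · exact Or.inr ⟨rfl, h'⟩
  · rintro (⟨rfl, h⟩ | ⟨rfl, h⟩)
    · exact ⟨by simp, h⟩
    · exact ⟨by simp, h⟩

theorem rowLen_twoRow (i : ℕ) :
    (twoRow n k hk).rowLen i = if i = 0 then n - k else if i = 1 then k else 0 := by
  apply eq_of_forall_lt_iff
  intro j
  rw [← YoungDiagram.mem_iff_lt_rowLen, mem_twoRow]
  split_ifs <;> omega

theorem colLen_twoRow (j : ℕ) :
    (twoRow n k hk).colLen j = (if j < n - k then 1 else 0) + if j < k then 1 else 0 := by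
  apply eq_of_forall_lt_iff
  intro i
  rw [← YoungDiagram.mem_iff_lt_colLen, mem_twoRow]
  split_ifs <;> omega

theorem card_twoRow : (twoRow n k hk).card = n := by
  have : (twoRow n k hk).cells =
      ({0} : Finset ℕ) ×ˢ Finset.range (n - k) ∪ ({1} : Finset ℕ) ×ˢ Finset.range k := by
    ext ⟨i, j⟩
    simp only [YoungDiagram.mem_cells, mem_twoRow, Finset.mem_union, Finset.mem_product,
      Finset.mem_range, Finset.mem_singleton]
  rw [YoungDiagram.card, this, Finset.card_union_of_disjoint]
  · simp only [Finset.card_product, Finset.card_singleton, Finset.card_range]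
    omega
  · rw [Finset.disjoint_left]
    rintro ⟨i, j⟩ h h'
    simp only [Finset.mem_product, Finset.mem_singleton] at h h'
    omega

theorem colExcess_twoRow (t : ℕ) :
    colExcess (twoRow n k hk) t = (min t (n - k) + min t k : ℕ) - (t : ℤ) := by
  rw [colExcess]
  congr 1
  induction t with
  | zero => simp
  | succ t ih =>
    rw [Finset.sum_range_succ, ih, colLen_twoRow]
    norm_cast
    split_ifs <;> omega

theorem sum_X_mem_tanisakiIdeal : ∑ i, X i ∈ tanisakiIdeal n (twoRow n k hk) := by
  rcases Nat.eq_zero_or_pos n with rfl | hn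
  · simp
  · refine Ideal.subset_span ⟨Finset.univ, 1, ?_,
      by rw [Finset.card_univ, Fintype.card_fin]; exact hn, ?_⟩
    · rw [colExcess_twoRow]
      simp
    · simp [partialEsymm, Finset.powersetCard_one]

theorem partialEsymm_compl_singleton_two_mem (i : Fin n) :
    partialEsymm ({i}ᶜ : Finset (Fin n)) 2 ∈ tanisakiIdeal n (twoRow n k hk) := by
  have hc : ({i}ᶜ : Finset (Fin n)).card = n - 1 := by simp [Finset.card_compl]
  by_cases h : 2 ≤ n - 1
  · refine Ideal.subset_span ⟨{i}ᶜ, 2, ?_, by omega, rfl⟩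
    rw [hc, colExcess_twoRow]
    omega
  · rw [partialEsymm, Finset.powersetCard_eq_empty.2 (by omega)]
    simp

theorem partialEsymm_univ_two_mem :
    partialEsymm (Finset.univ : Finset (Fin n)) 2 ∈ tanisakiIdeal n (twoRow n k hk) := by
  by_cases h : 2 ≤ n
  · refine Ideal.subset_span ⟨Finset.univ, 2, ?_, by simpa using h, rfl⟩
    rw [colExcess_twoRow]
    simp
  · rw [partialEsymm, Finset.powersetCard_eq_empty.2 (by simpa using h)]
    simp

theorem partialEsymm_insert {n : ℕ} (i : Fin n) (A : Finset (Fin n)) (hi : i ∉ A) (r : ℕ) :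
    partialEsymm (insert i A) (r + 1) = partialEsymm A (r + 1) + X i * partialEsymm A r := by
  have hdisj : Disjoint (A.powersetCard (r + 1)) ((A.powersetCard r).image (insert i)) := by
    rw [Finset.disjoint_left]
    intro B hB hB'
    obtain ⟨B', -, rfl⟩ := Finset.mem_image.1 hB'
    exact hi ((Finset.mem_powersetCard.1 hB).1 (Finset.mem_insert_self _ _))
  have hinj : Set.InjOn (insert i) (A.powersetCard r : Set (Finset (Fin n))) := by
    intro B hB B' hB' h
    have h1 : i ∉ B := fun h => hi ((Finset.mem_powersetCard.1 hB).1 h)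
    have h2 : i ∉ B' := fun h => hi ((Finset.mem_powersetCard.1 hB').1 h)
    rw [← Finset.erase_insert h1, ← Finset.erase_insert h2]
    exact congrArg (fun s => Finset.erase s i) h
  rw [partialEsymm, Finset.powersetCard_succ_insert hi, Finset.sum_union hdisj,
    Finset.sum_image hinj, partialEsymm, partialEsymm, Finset.mul_sum]
  congr 1
  refine Finset.sum_congr rfl fun B hB => ?_
  rw [Finset.prod_insert fun h => hi ((Finset.mem_powersetCard.1 hB).1 h)]

theorem X_mul_X_mem_tanisakiIdeal (i : Fin n) :
    X i * X i ∈ tanisakiIdeal n (twoRow n k hk) := by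
  have hi : i ∉ ({i}ᶜ : Finset (Fin n)) := by simp
  have h1 : (∑ j, X j : MvPolynomial (Fin n) ℚ) = X i + partialEsymm {i}ᶜ 1 := by
    rw [partialEsymm, Finset.powersetCard_one, Finset.sum_map, ← Finset.add_sum_erase _ _
      (Finset.mem_univ i), Finset.compl_eq_univ_sdiff, Finset.sdiff_singleton_eq_erase]
    simp
  have h2 : partialEsymm (Finset.univ : Finset (Fin n)) 2 =
      partialEsymm {i}ᶜ 2 + X i * partialEsymm {i}ᶜ 1 := by
    rw [← partialEsymm_insert i _ hi, Finset.insert_compl_self]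
  -- Splitting off $x_i$ gives $e_1=x_i+e_1'$ and $e_2=e_2'+x_ie_1'$, primes denoting the other
  -- variables. Hence $x_i^2=x_ie_1-e_2+e_2'$.
  have : (X i * X i : MvPolynomial (Fin n) ℚ) = X i * ∑ j, X j -
      partialEsymm Finset.univ 2 + partialEsymm {i}ᶜ 2 := by
    rw [h1, h2]
    ring
  rw [this]
  exact Ideal.add_mem _ (Ideal.sub_mem _ (Ideal.mul_mem_left _ _ (sum_X_mem_tanisakiIdeal hk))
    (partialEsymm_univ_two_mem hk)) (partialEsymm_compl_singleton_two_mem hk i)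

/-- Stated for an arbitrary ideal because it serves twice: to find monomials in $I_\mu$, and to
place the generators of $I_\mu$ in the apolar ideal. -/
theorem mk_partialEsymm_eq {n : ℕ} (K : Ideal (MvPolynomial (Fin n) ℚ)) (h1 : ∑ i, X i ∈ K)
    (h2 : ∀ i, X i * X i ∈ K) (A : Finset (Fin n)) (r : ℕ) :
    Ideal.Quotient.mk K (partialEsymm A r) =
      (-1) ^ r * Ideal.Quotient.mk K (partialEsymm Aᶜ r) := by
  have := esymm_compl_of_mul_self_eq_zero (fun i => Ideal.Quotient.mk K (X i))
    (fun i => by rw [← map_mul]; exact Ideal.Quotient.eq_zero_iff_mem.2 (h2 i))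
    (by rw [← map_sum]; exact Ideal.Quotient.eq_zero_iff_mem.2 h1) A r
  simpa [partialEsymm, map_sum, map_prod] using this

/-- Squarefree monomials of ballot sets with more than `k` elements vanish in `R_μ`. -/
theorem prod_X_mem_tanisakiIdeal (A : Finset (Fin n)) (hA : k < A.card) (hA' : 2 * A.card ≤ n) :
    ∏ i ∈ A, X i ∈ tanisakiIdeal n (twoRow n k hk) := by
  -- A subset of size exactly $k+1$ suffices. Its monomial is $e_{k+1}(B)$, which agrees up to sign
  -- with $e_{k+1}(B^c)$. The latter is a generator: $2(k+1)\le n$ gives $c_{k+1}=k$ and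
  -- $k+1\le|B^c|$.
  obtain ⟨B, hBA, hB⟩ := Finset.exists_subset_card_eq (show k + 1 ≤ A.card from hA)
  have hBm : ∏ i ∈ B, X i ∈ tanisakiIdeal n (twoRow n k hk) := by
    have hc : Bᶜ.card = n - (k + 1) := by rw [Finset.card_compl, hB, Fintype.card_fin]
    have h1 : partialEsymm Bᶜ (k + 1) ∈ tanisakiIdeal n (twoRow n k hk) := by
      refine Ideal.subset_span ⟨Bᶜ, k + 1, ?_, by omega, rfl⟩
      rw [hc, colExcess_twoRow]
      omega
    have h2 := mk_partialEsymm_eq _ (sum_X_mem_tanisakiIdeal hk) (X_mul_X_mem_tanisakiIdeal hk) B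
      (k + 1)
    rw [Ideal.Quotient.eq_zero_iff_mem.2 h1, mul_zero, Ideal.Quotient.eq_zero_iff_mem,
      partialEsymm, ← hB, Finset.powersetCard_self, Finset.sum_singleton] at h2
    exact h2
  rw [← Finset.prod_sdiff hBA]
  exact Ideal.mul_mem_left _ _ hBm

end TwoRow

/-! ### Harmonic polynomials -/

section Harmonic

variable {n : ℕ}

/-- The apolar pairing with `q`: the linear form that maps a monomial `x^m` to `m!` times the
coefficient of `x^m` in `q`. -/
def apolar (q : MvPolynomial (Fin n) ℚ) : MvPolynomial (Fin n) ℚ →ₗ[ℚ] ℚ :=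
  (basisMonomials (Fin n) ℚ).constr ℚ fun m => (∏ i, ((m i).factorial : ℚ)) * coeff m q

theorem apolar_monomial (q : MvPolynomial (Fin n) ℚ) (m : Fin n →₀ ℕ) :
    apolar q (monomial m 1) = (∏ i, ((m i).factorial : ℚ)) * coeff m q := by
  have h := (basisMonomials (Fin n) ℚ).constr_basis ℚ
    (fun m => (∏ i, ((m i).factorial : ℚ)) * coeff m q) m
  rwa [coe_basisMonomials] at h

/-- Multiplication by $x_i$ is adjoint to $\partial_i$ because raising the $i$-th exponent
multiplies the factorial weight by $m_i+1$, the same factor that differentiation produces. -/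
theorem apolar_X_mul (q : MvPolynomial (Fin n) ℚ) (i : Fin n) (p : MvPolynomial (Fin n) ℚ) :
    apolar q (X i * p) = apolar (pderiv i q) p := by
  have : apolar q ∘ₗ LinearMap.mulLeft ℚ (X i) = apolar (pderiv i q) := by
    refine (basisMonomials (Fin n) ℚ).ext fun m => ?_
    rw [coe_basisMonomials, LinearMap.comp_apply, LinearMap.mulLeft_apply, X, monomial_mul, one_mul,
      apolar_monomial, apolar_monomial, coeff_pderiv, add_comm (Finsupp.single i 1) m]
    have : ∏ j, (((m + Finsupp.single i 1 : Fin n →₀ ℕ) j).factorial : ℚ) =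
        (m i + 1) * ∏ j, ((m j).factorial : ℚ) := by
      rw [← Finset.mul_prod_erase _ _ (Finset.mem_univ i),
        ← Finset.mul_prod_erase Finset.univ (fun j => ((m j).factorial : ℚ)) (Finset.mem_univ i),
        ← mul_assoc]
      congr 1
      · simp [Nat.factorial_succ]
      · refine Finset.prod_congr rfl fun j hj => ?_
        rw [Finsupp.add_apply, Finsupp.single_eq_of_ne (Finset.ne_of_mem_erase hj), add_zero]
    rw [this]
    ring
  exact LinearMap.congr_fun this p

/-- Pairing $q$ with itself gives the sum of $m!$ times the squares of its coefficients, a sum of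
nonnegative rationals. -/
theorem eq_zero_of_apolar_self {q : MvPolynomial (Fin n) ℚ} (h : apolar q q = 0) : q = 0 := by
  rw [apolar, Module.Basis.constr_apply, Finsupp.sum] at h
  have hnn : ∀ m ∈ ((basisMonomials (Fin n) ℚ).repr q).support,
      0 ≤ (basisMonomials (Fin n) ℚ).repr q m •
        ((∏ i, ((m i).factorial : ℚ)) * coeff m q) := by
    intro m _
    change 0 ≤ coeff m q * _
    rw [mul_left_comm]
    exact mul_nonneg (Finset.prod_nonneg fun _ _ => by positivity) (mul_self_nonneg _)
  rw [Finset.sum_eq_zero_iff_of_nonneg hnn] at h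
  ext m
  by_contra hm
  rw [coeff_zero] at hm
  have h1 := h m (Finsupp.mem_support_iff.2 hm)
  change coeff m q * _ = 0 at h1
  have h2 : (∏ i, ((m i).factorial : ℚ)) ≠ 0 :=
    Finset.prod_ne_zero_iff.2 fun i _ => by exact_mod_cast Nat.factorial_ne_zero _
  exact mul_ne_zero hm (mul_ne_zero h2 hm) h1

/-- The multilinear polynomials of degree at most `k` that are killed by `∑ i, ∂_i`. -/
def harmonicSubmodule (n k : ℕ) : Submodule ℚ (MvPolynomial (Fin n) ℚ) where
  carrier := {q | ∑ i, pderiv i q = 0 ∧ ∀ m, coeff m q ≠ 0 → (∀ i, m i ≤ 1) ∧ ∑ i, m i ≤ k}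
  zero_mem' := by simp
  add_mem' := by
    rintro p q ⟨hp, hp'⟩ ⟨hq, hq'⟩
    refine ⟨by simp [Finset.sum_add_distrib, hp, hq], fun m hm => ?_⟩
    by_cases h : coeff m p = 0
    · exact hq' m (by simpa [h] using hm)
    · exact hp' m h
  smul_mem' := by
    rintro a q ⟨hq, hq'⟩
    refine ⟨by simp [← Finset.smul_sum, hq], fun m hm => hq' m fun h => hm ?_⟩
    simp [h]

/-- By adjointness, stability under derivatives is what makes the orthogonal complement an ideal. -/
theorem pderiv_mem_harmonic {k : ℕ} {q : MvPolynomial (Fin n) ℚ} (hq : q ∈ harmonicSubmodule n k)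
    (i : Fin n) : pderiv i q ∈ harmonicSubmodule n k := by
  have hcomm : ∀ j, pderiv j (pderiv i q) = pderiv i (pderiv j q) := by
    intro j
    ext m
    simp only [coeff_pderiv, Finsupp.add_apply]
    rw [add_right_comm]
    by_cases hij : i = j
    · subst hij
      ring
    · rw [Finsupp.single_eq_of_ne hij, Finsupp.single_eq_of_ne (Ne.symm hij)]
      push_cast
      ring
  refine ⟨by simp_rw [hcomm, ← map_sum, hq.1, map_zero], fun m hm => ?_⟩
  rw [coeff_pderiv] at hm
  obtain ⟨h1, h2⟩ := hq.2 _ (left_ne_zero_of_mul hm)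
  refine ⟨fun j => le_trans (by simp) (h1 j), le_trans ?_ h2⟩
  exact Finset.sum_le_sum fun j _ => by simp

/-- The ideal of the polynomials that are orthogonal to the harmonic polynomials. -/
def apolarIdeal (n k : ℕ) : Ideal (MvPolynomial (Fin n) ℚ) where
  carrier := {p | ∀ q ∈ harmonicSubmodule n k, apolar q p = 0}
  zero_mem' := by simp
  add_mem' := by
    intro p p' hp hp' q hq
    rw [map_add, hp q hq, hp' q hq, add_zero]
  smul_mem' := by
    intro c p hp
    induction c using MvPolynomial.induction_on with
    | C a =>
      intro q hq
      rw [smul_eq_mul, C_mul', map_smul, hp q hq, smul_zero]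
    | add c d hc hd =>
      intro q hq
      rw [add_smul, map_add, hc q hq, hd q hq, add_zero]
    | mul_X c i hc =>
      intro q hq
      rw [smul_eq_mul, mul_comm c, mul_assoc, apolar_X_mul]
      exact hc _ (pderiv_mem_harmonic hq i)

theorem sum_X_mem_apolarIdeal (n k : ℕ) : ∑ i, X i ∈ apolarIdeal n k := by
  intro q hq
  have h : ∀ i, apolar q (X i) = coeff 0 (pderiv i q) := by
    intro i
    rw [← mul_one (X i), apolar_X_mul, show (1 : MvPolynomial (Fin n) ℚ) = monomial 0 1 from rfl,
      apolar_monomial]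
    simp
  rw [map_sum, Finset.sum_congr rfl fun i _ => h i, ← coeff_sum, hq.1, coeff_zero]

theorem X_mul_X_mem_apolarIdeal (n k : ℕ) (i : Fin n) : X i * X i ∈ apolarIdeal n k := by
  intro q hq
  rw [X, monomial_mul, one_mul, apolar_monomial, mul_eq_zero]
  right
  by_contra h
  have := (hq.2 _ h).1 i
  simp at this

theorem prod_X_mem_apolarIdeal (n k : ℕ) (B : Finset (Fin n)) (hB : k < B.card) :
    ∏ i ∈ B, X i ∈ apolarIdeal n k := by
  intro q hq
  have : (∏ i ∈ B, X i : MvPolynomial (Fin n) ℚ) =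
      monomial (∑ i ∈ B, Finsupp.single i 1) 1 := by
    rw [monomial_sum_one]
    rfl
  rw [this, apolar_monomial, mul_eq_zero]
  right
  by_contra h
  have h2 := (hq.2 _ h).2
  simp only [Finsupp.finsetSum_apply] at h2
  rw [Finset.sum_comm] at h2
  simp [Finsupp.single_apply] at h2
  omega

/-- Replace $e_r(A)$ by $\pm e_r(A^c)$ and put $t=|A^c|$. If $t\le k$ then $c_t=t<r$ and the sum is
empty. If $k<t\le n-k$ then $c_t=k$, so every term has more than $k$ variables. If $t>n-k$ then
$c_t=|A|$, which excludes every $r\le|A|$. -/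
theorem tanisakiIdeal_le_apolarIdeal {k : ℕ} (hk : 2 * k ≤ n) :
    tanisakiIdeal n (twoRow n k hk) ≤ apolarIdeal n k := by
  refine Ideal.span_le.2 ?_
  rintro p ⟨A, r, h1, h2, rfl⟩
  have hA : A.card ≤ n := by simpa using Finset.card_le_univ A
  have hc : Aᶜ.card = n - A.card := by rw [Finset.card_compl, Fintype.card_fin]
  rw [colExcess_twoRow] at h1
  change partialEsymm A r ∈ apolarIdeal n k
  rw [← Ideal.Quotient.eq_zero_iff_mem, mk_partialEsymm_eq _ (sum_X_mem_apolarIdeal n k)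
    (X_mul_X_mem_apolarIdeal n k)]
  suffices partialEsymm Aᶜ r ∈ apolarIdeal n k by
    rw [Ideal.Quotient.eq_zero_iff_mem.2 this, mul_zero]
  refine Ideal.sum_mem _ fun B hB => ?_
  obtain ⟨hB1, hB2⟩ := Finset.mem_powersetCard.1 hB
  have := Finset.card_le_card hB1
  exact prod_X_mem_apolarIdeal n k B (by omega)

theorem eq_zero_of_mem_harmonic_of_mem_tanisakiIdeal {k : ℕ} (hk : 2 * k ≤ n)
    {q : MvPolynomial (Fin n) ℚ} (hq : q ∈ harmonicSubmodule n k)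
    (hq' : q ∈ tanisakiIdeal n (twoRow n k hk)) : q = 0 :=
  eq_zero_of_apolar_self (tanisakiIdeal_le_apolarIdeal hk hq' q hq)

/-- A submodule of `R_μ` that contains the squarefree monomials of the ballot sets with at most
`k` elements is everything. -/
theorem eq_top_of_isBallot_mem {k : ℕ} (hk : 2 * k ≤ n)
    (W : Submodule ℚ (GarsiaProcesi n (twoRow n k hk)))
    (hW : ∀ A : Finset (Fin n), IsBallot A → A.card ≤ k →
      Ideal.Quotient.mk (tanisakiIdeal n (twoRow n k hk)) (∏ i ∈ A, X i) ∈ W) : W = ⊤ := by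
  set x : Fin n → GarsiaProcesi n (twoRow n k hk) := fun i => Ideal.Quotient.mk _ (X i) with hxdef
  have hx : ∀ i, x i * x i = 0 := fun i => by
    rw [hxdef]
    simp only
    rw [← map_mul]
    exact Ideal.Quotient.eq_zero_iff_mem.2 (X_mul_X_mem_tanisakiIdeal hk i)
  have h0 : ∑ i, x i = 0 := by
    rw [hxdef, ← map_sum]
    exact Ideal.Quotient.eq_zero_iff_mem.2 (sum_X_mem_tanisakiIdeal hk)
  have hprod : ∀ A : Finset (Fin n), ∏ i ∈ A, x i ∈ W := by
    refine prod_mem_of_isBallot x hx h0 W fun A hA => ?_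
    rw [hxdef, ← map_prod]
    by_cases hAk : A.card ≤ k
    · exact hW A hA hAk
    -- The ballot condition on the whole index set says $2|A|\le n$, which makes the vanishing of
    -- large monomials applicable.
    · have h1 := hA n
      simp only [Fin.is_lt, Finset.filter_true] at h1
      rw [Finset.card_compl, Fintype.card_fin] at h1
      rw [Ideal.Quotient.eq_zero_iff_mem.2 (prod_X_mem_tanisakiIdeal hk A (by omega) (by omega))]
      exact W.zero_mem
  rw [eq_top_iff]
  intro y _
  have hy : y ∈ Algebra.adjoin ℚ (x '' Set.univ) := by
    obtain ⟨p, rfl⟩ := Ideal.Quotient.mk_surjective y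
    induction p using MvPolynomial.induction_on with
    | C a => exact Subalgebra.algebraMap_mem _ a
    | add p q hp hq =>
      rw [map_add]
      exact Subalgebra.add_mem _ (hp trivial) (hq trivial)
    | mul_X p i hp =>
      rw [map_mul]
      exact Subalgebra.mul_mem _ (hp trivial) (Algebra.subset_adjoin ⟨i, trivial, rfl⟩)
  refine Submodule.span_le.2 ?_ (adjoin_le_span_prod x hx _ hy)
  rintro _ ⟨D, -, rfl⟩
  exact hprod D

end Harmonic

/-! ### Cocharge words in two letters -/

section TwoLetters

variable {α : Type*} [LinearOrder α]

/-- Seen from any letter $1$, the letters $2$ to the left are exactly those of `P`; the search wraps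
around only when `P` is exhausted. -/
theorem cprev_two_eq {w : α → ℕ} {A : Finset α} {P : α → Prop} [DecidablePred P] {a : α}
    (haA : a ∈ A) (ha : w a = 1)
    (h1 : ∀ p ∈ A, P p → w p = 2 ∧ ∀ q ∈ A, w q = 1 → p < q)
    (h2 : ∀ p ∈ A, ¬ P p → w p = 2 → ∀ q ∈ A, w q = 1 → q < p) :
    cprev w A 2 (a : WithBot α) =
      if (A.filter P).Nonempty then (A.filter P).max else (A.filter fun q => w q = 2).max := by
  have : (A.filter fun q => w q = 2 ∧ (q : WithBot α) < a) = A.filter P := by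
    ext q
    simp only [Finset.mem_filter, WithBot.coe_lt_coe]
    constructor
    · rintro ⟨hq, hq2, hqa⟩
      by_contra hP
      exact lt_asymm hqa (h2 q hq (fun h => hP ⟨hq, h⟩) hq2 a haA ha)
    · rintro ⟨hq, hP⟩
      exact ⟨hq, (h1 q hq hP).1, (h1 q hq hP).2 a haA ha⟩
  rw [cprev, this]

/-- In a word in the letters `1` and `2`, in which the letters `2` of a set `P` are to the left
of all letters `1` and the other letters `2` are to the right of them, the letters of `P` have
cocharge label one and all others have cocharge label zero, if `P` is not larger than the number
of letters `1`. -/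
theorem cwAux_of_two_letters (w : α → ℕ) (P : α → Prop) [DecidablePred P] (m : ℕ) (A : Finset α)
    (h0 : ∀ p ∈ A, w p = 1 ∨ w p = 2) (hm : (A.filter fun q => w q = 1).card = m)
    (h1 : ∀ p ∈ A, P p → w p = 2 ∧ ∀ q ∈ A, w q = 1 → p < q)
    (h2 : ∀ p ∈ A, ¬ P p → w p = 2 → ∀ q ∈ A, w q = 1 → q < p)
    (hP : (A.filter P).card ≤ m) : ∀ p ∈ A, cwAux w m A p = if P p then 1 else 0 := by
  induction m generalizing A with
  | zero =>
    intro p hp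
    -- With no rounds left every label takes the default value $0$. This is correct because `P` is
    -- empty by then.
    rw [cwAux, if_neg]
    intro hPp
    have := Finset.card_eq_zero.1 (Nat.le_zero.1 hP)
    exact Finset.notMem_empty p (this ▸ Finset.mem_filter.2 ⟨hp, hPp⟩)
  | succ m ih =>
    have hne : (A.filter fun q => w q = 1).Nonempty := by
      rw [← Finset.card_pos, hm]
      omega
    obtain ⟨a, ha⟩ := Finset.max_of_nonempty hne
    obtain ⟨haA, ha1⟩ := Finset.mem_filter.1 (Finset.mem_of_max ha)
    have hs1 : stdPos w A 1 = a := ha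
    have hs2 : stdPos w A 2 = if (A.filter P).Nonempty then (A.filter P).max
        else (A.filter fun q => w q = 2).max := by
      rw [← cprev_two_eq haA ha1 h1 h2, ← hs1]
      rfl
    have hfss1 : ∀ p ∈ A, w p = 1 → (p ∈ firstStandardSubword w A ↔ p = a) := by
      intro p hp hp1
      rw [firstStandardSubword, Finset.mem_filter, hp1, hs1, WithBot.coe_inj]
      simp [hp, eq_comm]
    have hfss2 : ∀ p ∈ firstStandardSubword w A, w p = 2 →
        stdPos w A 2 = (p : WithBot α) := by
      intro p hp hp2
      rw [firstStandardSubword, Finset.mem_filter, hp2] at hp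
      exact hp.2
    have hlab : ∀ p ∈ A, p ∈ firstStandardSubword w A → w p = 2 →
        stdLabel w A 2 = if P p then 1 else 0 := by
      intro p hp hpf hp2
      have hl : stdLabel w A 2 = if stdPos w A 1 < stdPos w A 2 then 0 else 1 := rfl
      rw [hl, hs1, hfss2 p hpf hp2]
      simp only [WithBot.coe_lt_coe]
      by_cases hPp : P p
      · rw [if_neg (lt_asymm ((h1 p hp hPp).2 a haA ha1)), if_pos hPp]
      · rw [if_pos (h2 p hp hPp hp2 a haA ha1), if_neg hPp]
    have hones : ((A \ firstStandardSubword w A).filter fun q => w q = 1).card = m := by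
      have : ((A \ firstStandardSubword w A).filter fun q => w q = 1) =
          (A.filter fun q => w q = 1).erase a := by
        ext q
        simp only [Finset.mem_filter, Finset.mem_sdiff, Finset.mem_erase]
        constructor
        · rintro ⟨⟨hq, hqf⟩, hq1⟩
          exact ⟨fun h => hqf ((hfss1 q hq hq1).2 h), hq, hq1⟩
        · rintro ⟨hqa, hq, hq1⟩
          exact ⟨⟨hq, fun h => hqa ((hfss1 q hq hq1).1 h)⟩, hq1⟩
      rw [this, Finset.card_erase_of_mem (Finset.mem_of_max ha), hm, Nat.add_sub_cancel]
    -- Each round uses up one letter $1$ and, while any remain, one letter of `P`. Thus `P` is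
    -- exhausted no later than the letters $1$.
    have hPs : ((A \ firstStandardSubword w A).filter P).card ≤ m := by
      by_cases hne' : (A.filter P).Nonempty
      · obtain ⟨b, hb⟩ := Finset.max_of_nonempty hne'
        obtain ⟨hbA, hbP⟩ := Finset.mem_filter.1 (Finset.mem_of_max hb)
        have hbf : b ∈ firstStandardSubword w A := by
          rw [firstStandardSubword, Finset.mem_filter, (h1 b hbA hbP).1, hs2, if_pos hne', hb]
          exact ⟨hbA, rfl⟩
        have hsub : (A \ firstStandardSubword w A).filter P ⊆ (A.filter P).erase b := by
          intro q hq
          simp only [Finset.mem_filter, Finset.mem_sdiff, Finset.mem_erase] at hq ⊢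
          exact ⟨fun h => hq.1.2 (h ▸ hbf), hq.1.1, hq.2⟩
        have := Finset.card_le_card hsub
        rw [Finset.card_erase_of_mem (Finset.mem_of_max hb)] at this
        omega
      · rw [Finset.not_nonempty_iff_eq_empty] at hne'
        have hsub : (A \ firstStandardSubword w A).filter P ⊆ A.filter P :=
          Finset.filter_subset_filter _ Finset.sdiff_subset
        rw [hne', Finset.subset_empty] at hsub
        simp [hsub]
    intro p hp
    rw [cwAux]
    split_ifs with hpf hPp hPp
    · rw [(h1 p hp hPp).1, hlab p hp hpf (h1 p hp hPp).1, if_pos hPp]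
    · rcases h0 p hp with h | h
      · rw [h]
        rfl
      · rw [h, hlab p hp hpf h, if_neg hPp]
    all_goals
      have hsd : ∀ q, q ∈ A \ firstStandardSubword w A → q ∈ A := fun q hq =>
        (Finset.mem_sdiff.1 hq).1
      rw [ih (A \ firstStandardSubword w A) (fun q hq => h0 q (hsd q hq)) hones
        (fun q hq hPq => ⟨(h1 q (hsd q hq) hPq).1, fun r hr => (h1 q (hsd q hq) hPq).2 r (hsd r hr)⟩)
        (fun q hq hPq hq2 r hr => h2 q (hsd q hq) hPq hq2 r (hsd r hr)) hPs p
        (Finset.mem_sdiff.2 ⟨hp, hpf⟩)]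
      simp [hPp]

end TwoLetters

/-! ### Semistandard tableaux whose content has two rows -/

section Semistandard

variable {n k : ℕ} {hk : 2 * k ≤ n} {ν : YoungDiagram} {S : SemistandardYoungTableau ν}

theorem HasContent.entry (hS : HasContent S (twoRow n k hk)) {i j : ℕ} (h : (i, j) ∈ ν) :
    S i j = 1 ∨ S i j = 2 := by
  have h0 := hS.1 (i, j) h
  by_contra hcon
  have h1 := hS.2 (S i j - 1)
  rw [rowLen_twoRow, if_neg (by simp only at h0; omega), if_neg (by simp only at h0; omega),
    Finset.card_eq_zero] at h1
  refine Finset.notMem_empty (i, j) (h1 ▸ Finset.mem_filter.2 ⟨h, ?_⟩)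
  simp only at h0 ⊢
  omega

theorem HasContent.row_le_one (hS : HasContent S (twoRow n k hk)) {i j : ℕ} (h : (i, j) ∈ ν) :
    i ≤ 1 := by
  by_contra hi
  have h1 := S.col_strict (show 0 < 1 by omega) (ν.up_left_mem (show 1 ≤ i by omega) le_rfl h)
  have h2 := S.col_strict (show 1 < i by omega) h
  have h3 := hS.entry (ν.up_left_mem (Nat.zero_le i) le_rfl h)
  have h4 := hS.entry h
  omega

theorem HasContent.entry_one (hS : HasContent S (twoRow n k hk)) {j : ℕ} (h : (1, j) ∈ ν) :
    S 0 j = 1 ∧ S 1 j = 2 := by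
  have h1 := S.col_strict (show 0 < 1 by omega) h
  have h2 := hS.entry (ν.up_left_mem (Nat.zero_le 1) le_rfl h)
  have h3 := hS.entry h
  omega

theorem HasContent.rowLen_one_le (hS : HasContent S (twoRow n k hk)) : ν.rowLen 1 ≤ k := by
  have h := hS.2 1
  rw [rowLen_twoRow, if_neg one_ne_zero, if_pos rfl] at h
  rw [YoungDiagram.rowLen_eq_card, ← h]
  refine Finset.card_le_card fun c hc => ?_
  obtain ⟨i, j⟩ := c
  obtain ⟨hc, rfl⟩ := YoungDiagram.mem_row_iff.1 hc
  exact Finset.mem_filter.2 ⟨hc, (hS.entry_one hc).2⟩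

theorem HasContent.card_ones (hS : HasContent S (twoRow n k hk)) :
    (ν.cells.filter fun c => S c.1 c.2 = 1).card = n - k := by
  have h := hS.2 0
  rwa [rowLen_twoRow, if_pos rfl] at h

theorem HasContent.ones_eq (hS : HasContent S (twoRow n k hk)) {i j : ℕ} (h : (i, j) ∈ ν)
    (h1 : S i j = 1) : i = 0 := by
  have := hS.row_le_one h
  by_contra hi
  obtain rfl : i = 1 := by omega
  have := (hS.entry_one h).2
  omega

/-- In a semistandard tableau with content `(n - k, k)`, the first `n - k` entries of the bottom
row are `1`. -/
theorem HasContent.entry_zero (hS : HasContent S (twoRow n k hk)) {j : ℕ} (h : (0, j) ∈ ν) :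
    S 0 j = if j < n - k then 1 else 2 := by
  have hc := hS.card_ones
  have hent := hS.entry h
  split_ifs with hj
  · by_contra h1
    have h2 : S 0 j = 2 := by omega
    have hsub : (ν.cells.filter fun c => S c.1 c.2 = 1) ⊆ ({0} : Finset ℕ) ×ˢ Finset.range j := by
      rintro ⟨i', j'⟩ hc'
      obtain ⟨hm, h1'⟩ := Finset.mem_filter.1 hc'
      have hi := hS.ones_eq hm h1'
      simp only at hi h1'
      subst hi
      rw [Finset.mem_product, Finset.mem_singleton, Finset.mem_range]
      refine ⟨rfl, ?_⟩
      by_contra hjj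
      have := S.row_weak_of_le (show j ≤ j' by simpa using hjj) hm
      omega
    have := Finset.card_le_card hsub
    rw [hc] at this
    simp at this
    omega
  · by_contra h1
    have h2 : S 0 j = 1 := by omega
    have hsub : ({0} : Finset ℕ) ×ˢ Finset.range (j + 1) ⊆
        (ν.cells.filter fun c => S c.1 c.2 = 1) := by
      rintro ⟨i', j'⟩ hc'
      rw [Finset.mem_product, Finset.mem_singleton, Finset.mem_range] at hc'
      obtain ⟨hi, hj'⟩ := hc'
      simp only at hi hj'
      subst hi
      have hm : (0, j') ∈ ν := ν.up_left_mem le_rfl (by omega) h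
      have h3 := S.row_weak_of_le (show j' ≤ j by omega) h
      have h4 := hS.entry hm
      exact Finset.mem_filter.2 ⟨hm, by simp only; omega⟩
    have := Finset.card_le_card hsub
    rw [hc] at this
    simp at this
    omega

/-- All entries are forced: the second row consists of $2$s, and the bottom row is $n-k$ ones
followed by twos. -/
theorem HasContent.eq {S' : SemistandardYoungTableau ν} (hS : HasContent S (twoRow n k hk))
    (hS' : HasContent S' (twoRow n k hk)) : S = S' := by
  ext i j
  by_cases h : (i, j) ∈ ν
  · have hi := hS.row_le_one h
    obtain rfl | rfl : i = 0 ∨ i = 1 := by omega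
    · rw [hS.entry_zero h, hS'.entry_zero h]
    · rw [(hS.entry_one h).2, (hS'.entry_one h).2]
  · rw [S.zeros h, S'.zeros h]

theorem square_readPos (c : ℕ × ℕ) : square (readPos c) = c := rfl

theorem readPos_injective : Function.Injective readPos := fun c d h => by
  rw [← square_readPos c, h, square_readPos]

theorem readPos_lt_readPos {c d : ℕ × ℕ} :
    readPos c < readPos d ↔ d.1 < c.1 ∨ c.1 = d.1 ∧ c.2 < d.2 := by
  rw [readPos, readPos, Prod.Lex.toLex_lt_toLex]
  simp only [OrderDual.toDual_lt_toDual, EmbeddingLike.apply_eq_iff_eq]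

/-- The cocharge label of a square of a tableau with content `(n - k, k)` is its row. -/
theorem HasContent.cwTableau_eq (hS : HasContent S (twoRow n k hk)) {c : ℕ × ℕ} (hc : c ∈ ν) :
    cwTableau S c = c.1 := by
  have hones : ((ν.cells.image readPos).filter fun q =>
      S (square q).1 (square q).2 = 1).card = n - k := by
    rw [← hS.card_ones, Finset.filter_image, Finset.card_image_of_injective _ readPos_injective]
    rfl
  -- Take `P` to be the second row: it is read first, then the ones, then the twos of the bottom
  -- row. Its size is at most $k\le n-k$, the number of ones.
  rw [cwTableau, cochargeWord, hones, cwAux_of_two_letters _ (fun p => (square p).1 = 1) _ _ _ hones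
    _ _ _ _ (Finset.mem_image_of_mem _ hc)]
  · have := hS.row_le_one (i := c.1) (j := c.2) hc
    rw [square_readPos]
    split_ifs <;> omega
  · intro p hp
    obtain ⟨⟨i, j⟩, hd, rfl⟩ := Finset.mem_image.1 hp
    exact hS.entry hd
  · intro p hp hp1
    obtain ⟨⟨i, j⟩, hd, rfl⟩ := Finset.mem_image.1 hp
    obtain rfl : i = 1 := hp1
    refine ⟨(hS.entry_one hd).2, fun q hq hq1 => ?_⟩
    obtain ⟨⟨i', j'⟩, hd', rfl⟩ := Finset.mem_image.1 hq
    have := hS.ones_eq hd' hq1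
    rw [readPos_lt_readPos]
    simp only
    omega
  · intro p hp hp1 hp2 q hq hq1
    obtain ⟨⟨i, j⟩, hd, rfl⟩ := Finset.mem_image.1 hp
    obtain ⟨⟨i', j'⟩, hd', rfl⟩ := Finset.mem_image.1 hq
    have h1 := hS.ones_eq hd' hq1
    have h2 : i ≤ 1 := hS.row_le_one hd
    simp only [square_readPos] at hp1 hp2 hq1
    obtain rfl : i = 0 := by omega
    subst h1
    rw [readPos_lt_readPos]
    refine Or.inr ⟨rfl, ?_⟩
    simp only
    by_contra hjj
    have := S.row_weak_of_le (show j ≤ j' by omega) hd'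
    omega
  · have : (ν.cells.image readPos).filter (fun p => (square p).1 = 1) = (ν.row 1).image readPos := by
      rw [Finset.filter_image]
      rfl
    rw [this, Finset.card_image_of_injective _ readPos_injective, ← YoungDiagram.rowLen_eq_card]
    have := hS.rowLen_one_le
    omega

/-- Fill the second row with $j$ twos and the bottom row with $n-k$ ones followed by $k-j$ twos.
Columns increase strictly because $j\le k\le n-k$ keeps the second row above ones. -/
theorem exists_hasContent {j : ℕ} (hj : j ≤ k) (hjn : 2 * j ≤ n) :
    ∃ S : SemistandardYoungTableau (twoRow n j hjn), HasContent S (twoRow n k hk) := by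
  refine ⟨⟨fun a b => if a = 0 ∧ b < n - k then 1 else if (a, b) ∈ (twoRow n j hjn).cells then 2
    else 0, ?_, ?_, ?_⟩, ?_, ?_⟩
  · intro a b c hbc hc
    have hb : (a, b) ∈ twoRow n j hjn := (twoRow n j hjn).up_left_mem le_rfl hbc.le hc
    rw [if_pos (YoungDiagram.mem_cells _ |>.2 hc), if_pos (YoungDiagram.mem_cells _ |>.2 hb)]
    split_ifs <;> omega
  · intro a b c hab hc
    have hb : (a, c) ∈ twoRow n j hjn := (twoRow n j hjn).up_left_mem hab.le le_rfl hc
    rw [if_pos (YoungDiagram.mem_cells _ |>.2 hc), if_pos (YoungDiagram.mem_cells _ |>.2 hb)]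
    rw [mem_twoRow] at hc hb
    rw [if_pos (by omega), if_neg (by omega)]
    omega
  · intro a b hab
    rw [if_neg (mt (YoungDiagram.mem_cells _).1 hab), if_neg]
    rw [mem_twoRow] at hab
    omega
  · rintro ⟨a, b⟩ hc
    change 0 < if a = 0 ∧ b < n - k then 1 else if (a, b) ∈ (twoRow n j hjn).cells then 2 else 0
    rw [if_pos hc]
    split_ifs <;> omega
  · intro i
    have key : ∀ c ∈ (twoRow n j hjn).cells, (if c.1 = 0 ∧ c.2 < n - k then 1 else
        if (c.1, c.2) ∈ (twoRow n j hjn).cells then 2 else 0) =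
        if c.1 = 0 ∧ c.2 < n - k then 1 else 2 := by
      intro c hc
      rw [if_pos (show (c.1, c.2) ∈ (twoRow n j hjn).cells from hc)]
    change (((twoRow n j hjn).cells.filter fun c => (if c.1 = 0 ∧ c.2 < n - k then 1 else
        if (c.1, c.2) ∈ (twoRow n j hjn).cells then 2 else 0) = i + 1)).card = _
    rw [Finset.filter_congr fun c hc => by rw [key c hc], rowLen_twoRow]
    have h1 : ((twoRow n j hjn).cells.filter fun c => c.1 = 0 ∧ c.2 < n - k) =
        ({0} : Finset ℕ) ×ˢ Finset.range (n - k) := by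
      ext ⟨a, b⟩
      simp only [Finset.mem_filter, YoungDiagram.mem_cells, mem_twoRow, Finset.mem_product,
        Finset.mem_singleton, Finset.mem_range]
      omega
    have hcard1 : ((twoRow n j hjn).cells.filter fun c => c.1 = 0 ∧ c.2 < n - k).card = n - k := by
      rw [h1]
      simp
    have hcard2 := Finset.card_filter_add_card_filter_not (s := (twoRow n j hjn).cells)
      (fun c => c.1 = 0 ∧ c.2 < n - k)
    have hcard3 : (twoRow n j hjn).cells.card = n := card_twoRow hjn
    rcases i with _ | _ | i
    · rw [if_pos rfl, ← hcard1]
      congr 1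
      refine Finset.filter_congr fun c _ => ?_
      split_ifs <;> simp_all
    · rw [if_neg (by omega), if_pos rfl]
      have : ((twoRow n j hjn).cells.filter fun c =>
          (if c.1 = 0 ∧ c.2 < n - k then 1 else 2) = 0 + 1 + 1) =
          (twoRow n j hjn).cells.filter fun c => ¬ (c.1 = 0 ∧ c.2 < n - k) := by
        refine Finset.filter_congr fun c _ => ?_
        split_ifs <;> simp_all
      rw [this]
      omega
    · rw [if_neg (by omega), if_neg (by omega), Finset.card_eq_zero,
        Finset.filter_eq_empty_iff]
      intro c _
      split_ifs <;> omega

end Semistandard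

/-! ### Tableaux with two rows and ballot sets -/

section TopSet

variable {n : ℕ} {ν : YoungDiagram}

/-- The set of entries of the second row of a tableau. -/
def topSet (T : Tab n ν) : Finset (Fin n) :=
  Finset.univ.filter fun i => (T.symm i).1.1 = 1

theorem mem_topSet {T : Tab n ν} {i : Fin n} : i ∈ topSet T ↔ (T.symm i).1.1 = 1 := by
  simp [topSet]

theorem apply_mem_topSet {T : Tab n ν} {c : ν.cells} : T c ∈ topSet T ↔ c.1.1 = 1 := by
  rw [mem_topSet, Equiv.symm_apply_apply]

theorem card_topSet (T : Tab n ν) : (topSet T).card = ν.rowLen 1 := by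
  rw [YoungDiagram.rowLen_eq_card]
  refine Finset.card_bij (fun i _ => (T.symm i).1) ?_ ?_ ?_
  · intro i hi
    exact YoungDiagram.mem_row_iff.2 ⟨(T.symm i).2, mem_topSet.1 hi⟩
  · intro i _ j _ h
    exact T.symm.injective (Subtype.ext h)
  · intro c hc
    obtain ⟨hc, h1⟩ := YoungDiagram.mem_row_iff.1 hc
    exact ⟨T ⟨c, hc⟩, apply_mem_topSet.2 h1, by simp⟩

theorem eq_of_rowLen_one_eq {ν' : YoungDiagram} (hν : ∀ c ∈ ν, c.1 ≤ 1) (hν' : ∀ c ∈ ν', c.1 ≤ 1)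
    (hcard : ν.card = ν'.card) (h : ν.rowLen 1 = ν'.rowLen 1) : ν = ν' := by
  have hrow : ∀ ρ : YoungDiagram, (∀ c ∈ ρ, c.1 ≤ 1) → ρ.card = ρ.rowLen 0 + ρ.rowLen 1 := by
    intro ρ hρ
    have : ρ.cells = ρ.row 0 ∪ ρ.row 1 := by
      ext c
      simp only [YoungDiagram.mem_cells, Finset.mem_union, YoungDiagram.mem_row_iff]
      constructor
      · intro hc
        have := hρ c hc
        have : c.1 = 0 ∨ c.1 = 1 := by omega
        tauto
      · tauto
    rw [YoungDiagram.card, this, Finset.card_union_of_disjoint, YoungDiagram.rowLen_eq_card,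
      YoungDiagram.rowLen_eq_card]
    rw [Finset.disjoint_left]
    intro c hc hc'
    rw [YoungDiagram.mem_row_iff] at hc hc'
    omega
  have h0 : ν.rowLen 0 = ν'.rowLen 0 := by
    have h1 := hrow ν hν
    have h2 := hrow ν' hν'
    omega
  have hsub : ∀ ρ ρ' : YoungDiagram, (∀ c ∈ ρ, c.1 ≤ 1) → ρ.rowLen 0 = ρ'.rowLen 0 →
      ρ.rowLen 1 = ρ'.rowLen 1 → ρ ≤ ρ' := by
    rintro ρ ρ' hρ h0 h1 ⟨i, j⟩ hc
    have hi : i ≤ 1 := hρ _ hc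
    have hc' : (i, j) ∈ ρ := hc
    change (i, j) ∈ ρ'
    rw [YoungDiagram.mem_iff_lt_rowLen] at hc' ⊢
    obtain rfl | rfl : i = 0 ∨ i = 1 := by omega
    · rwa [← h0]
    · rwa [← h1]
  exact le_antisymm (hsub _ _ hν h0 h) (hsub _ _ hν' h0.symm h.symm)

/-- A standard tableau with at most two rows is determined by the entries of its second row. -/
theorem IsStandard.eq_of_topSet_eq (hν : ∀ c ∈ ν, c.1 ≤ 1) {T T' : Tab n ν} (hT : IsStandard T)
    (hT' : IsStandard T') (h : topSet T = topSet T') : T = T' := by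
  have hrows : ∀ i m, (T.symm m).1.1 = i ↔ (T'.symm m).1.1 = i := by
    intro i m
    have h1 : (T.symm m).1.1 = 1 ↔ (T'.symm m).1.1 = 1 := by
      rw [← mem_topSet, h, mem_topSet]
    have h2 := hν _ (T.symm m).2
    have h3 := hν _ (T'.symm m).2
    omega
  have hcell : ∀ i (j : Fin (ν.rowLen i)), (i, j.1) ∈ ν.cells := fun i j =>
    YoungDiagram.mem_iff_lt_rowLen.2 j.2
  have hmono : ∀ (U : Tab n ν), IsStandard U → ∀ i,
      StrictMono fun j : Fin (ν.rowLen i) => U ⟨(i, j.1), hcell i j⟩ := fun U hU i j j' hj =>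
    hU.1 _ _ rfl hj
  have hrange : ∀ (U : Tab n ν) i,
      Set.range (fun j : Fin (ν.rowLen i) => U ⟨(i, j.1), hcell i j⟩) =
        {m | (U.symm m).1.1 = i} := by
    intro U i
    ext m
    constructor
    · rintro ⟨j, rfl⟩
      simp
    · intro hm
      obtain ⟨⟨⟨i', j⟩, hc⟩, rfl⟩ := U.surjective m
      simp only [Set.mem_ofPred_eq, Equiv.symm_apply_apply] at hm
      subst hm
      exact ⟨⟨j, YoungDiagram.mem_iff_lt_rowLen.1 hc⟩, rfl⟩
  ext1 c
  obtain ⟨⟨i, j⟩, hc⟩ := c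
  -- Each row enumerates its set of entries in increasing order, and a strictly increasing
  -- enumeration is determined by its range.
  have := ((hmono T hT i).range_inj (hmono T' hT' i)).1 (by
    rw [hrange, hrange]
    ext m
    exact hrows i m)
  exact congrFun this ⟨j, YoungDiagram.mem_iff_lt_rowLen.1 hc⟩

/-- Every ballot set is the set of entries of the second row of a standard tableau. -/
theorem IsBallot.exists_isStandard {A : Finset (Fin n)} (hA : IsBallot A)
    (h : 2 * A.card ≤ n) : ∃ T : Tab n (twoRow n A.card h), IsStandard T ∧ topSet T = A := by
  set j := A.card with hj
  have hcA : Aᶜ.card = n - j := by rw [Finset.card_compl, Fintype.card_fin]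
  set e := A.orderEmbOfFin hj.symm with he
  set e' := Aᶜ.orderEmbOfFin hcA with he'
  have heA : ∀ b, e b ∈ A := fun b => Finset.orderEmbOfFin_mem _ _ _
  have heA' : ∀ b, e' b ∉ A := fun b => Finset.mem_compl.1 (Finset.orderEmbOfFin_mem _ _ _)
  have hc1 : ∀ c : (twoRow n j h).cells, c.1.1 = 1 → c.1.2 < j := by
    rintro ⟨⟨a, b⟩, hc⟩ h1
    have := (mem_twoRow h).1 ((YoungDiagram.mem_cells _).1 hc)
    simp only at h1 ⊢
    omega
  have hc0 : ∀ c : (twoRow n j h).cells, c.1.1 ≠ 1 → c.1.1 = 0 ∧ c.1.2 < n - j := by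
    rintro ⟨⟨a, b⟩, hc⟩ h1
    have := (mem_twoRow h).1 ((YoungDiagram.mem_cells _).1 hc)
    simp only at h1 ⊢
    omega
  set f : (twoRow n j h).cells → Fin n := fun c =>
    if h1 : c.1.1 = 1 then e ⟨c.1.2, hc1 c h1⟩ else e' ⟨c.1.2, (hc0 c h1).2⟩ with hf
  have hf1 : ∀ c (h1 : c.1.1 = 1), f c = e ⟨c.1.2, hc1 c h1⟩ := fun c h1 => dif_pos h1
  have hf0 : ∀ c (h1 : c.1.1 ≠ 1), f c = e' ⟨c.1.2, (hc0 c h1).2⟩ := fun c h1 => dif_neg h1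
  have hfA : ∀ c, f c ∈ A ↔ c.1.1 = 1 := by
    intro c
    by_cases h1 : c.1.1 = 1
    · simp only [hf1 c h1, heA, h1]
    · simp only [hf0 c h1, heA', h1]
  have hinj : Function.Injective f := by
    intro c d hcd
    have hrow : c.1.1 = 1 ↔ d.1.1 = 1 := by rw [← hfA, hcd, hfA]
    by_cases h1 : c.1.1 = 1
    · rw [hf1 c h1, hf1 d (hrow.1 h1)] at hcd
      have := Fin.mk.inj_iff.1 (e.injective hcd)
      exact Subtype.ext (Prod.ext (h1.trans (hrow.1 h1).symm) this)
    · have h1' := mt hrow.2 h1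
      rw [hf0 c h1, hf0 d h1'] at hcd
      have := Fin.mk.inj_iff.1 (e'.injective hcd)
      exact Subtype.ext (Prod.ext ((hc0 c h1).1.trans (hc0 d h1').1.symm) this)
  have hbij : Function.Bijective f := by
    rw [Fintype.bijective_iff_injective_and_card]
    refine ⟨hinj, ?_⟩
    rw [Fintype.card_coe, Fintype.card_fin]
    exact card_twoRow h
  refine ⟨Equiv.ofBijective f hbij, ⟨?_, ?_⟩, ?_⟩
  · intro c d hrow hcol
    change f c < f d
    by_cases h1 : c.1.1 = 1
    · rw [hf1 c h1, hf1 d (hrow ▸ h1)]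
      exact e.strictMono hcol
    · rw [hf0 c h1, hf0 d (hrow ▸ h1)]
      exact e'.strictMono hcol
  · intro c d hcol hrow
    change f c < f d
    have h1 : c.1.1 ≠ 1 := fun hc => by
      have := hc0 d
      omega
    have h1' : d.1.1 = 1 := by
      by_contra hd
      have := hc0 d hd
      omega
    by_contra hlt
    have hne : f d ≠ f c := fun heq => h1 ((hfA c).1 (heq ▸ (hfA d).2 h1'))
    have hdc : f d < f c := lt_of_le_of_ne (not_lt.1 hlt) hne
    rw [hf1 d h1', hf0 c h1] at hdc
    -- Suppose a column with index $b$ decreases. The initial segment ending at its upper entry then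
    -- contains at least $b+1$ elements of `A` and at most $b$ of its complement, against the ballot
    -- condition.
    have hm := hA ((e ⟨d.1.2, hc1 d h1'⟩).1 + 1)
    have hge : d.1.2 + 1 ≤ (A.filter fun i => i.1 < (e ⟨d.1.2, hc1 d h1'⟩).1 + 1).card := by
      rw [← Fin.card_Iic ⟨d.1.2, hc1 d h1'⟩, ← Finset.card_map e.toEmbedding]
      refine Finset.card_le_card fun i hi => ?_
      obtain ⟨b, hb, rfl⟩ := Finset.mem_map.1 hi
      have := Fin.le_def.1 (e.monotone (Finset.mem_Iic.1 hb))
      exact Finset.mem_filter.2 ⟨heA b, Nat.lt_succ_of_le this⟩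
    have hle : (Aᶜ.filter fun i => i.1 < (e ⟨d.1.2, hc1 d h1'⟩).1 + 1).card ≤ c.1.2 := by
      have h2 : (Finset.Iio (⟨c.1.2, (hc0 c h1).2⟩ : Fin (n - j))).card = c.1.2 := Fin.card_Iio _
      rw [← h2, ← Finset.card_map e'.toEmbedding]
      refine Finset.card_le_card fun i hi => ?_
      obtain ⟨hiA, hi⟩ := Finset.mem_filter.1 hi
      have : i ∈ Set.range e' := by
        rw [he', Finset.range_orderEmbOfFin]
        exact hiA
      obtain ⟨b, rfl⟩ := this
      refine Finset.mem_map.2 ⟨b, Finset.mem_Iio.2 (e'.lt_iff_lt.1 (lt_of_le_of_lt ?_ hdc)), rfl⟩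
      exact Fin.le_def.2 (Nat.le_of_lt_succ hi)
    omega
  · ext i
    obtain ⟨c, rfl⟩ := (Equiv.ofBijective f hbij).surjective i
    rw [apply_mem_topSet]
    exact (hfA c).symm

end TopSet

/-! ### Specht polynomials of shapes with two rows -/

section Specht

variable {n : ℕ} {ν : YoungDiagram}

/-- The entry of the bottom row in the column of a given entry. -/
def below (T : Tab n ν) (i : Fin n) : Fin n :=
  T ⟨(0, (T.symm i).1.2), ν.up_left_mem (Nat.zero_le _) le_rfl (T.symm i).2⟩

theorem below_notMem_topSet (T : Tab n ν) (i : Fin n) : below T i ∉ topSet T := by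
  rw [below, apply_mem_topSet]
  simp

theorem symm_below (T : Tab n ν) (i : Fin n) : (T.symm (below T i)).1 = (0, (T.symm i).1.2) := by
  simp [below]

theorem eq_of_below_eq {T : Tab n ν} {i j : Fin n} (hi : i ∈ topSet T) (hj : j ∈ topSet T)
    (h : below T i = below T j) : i = j := by
  have h1 := symm_below T i
  rw [h, symm_below] at h1
  exact T.symm.injective (Subtype.ext (Prod.ext ((mem_topSet.1 hi).trans (mem_topSet.1 hj).symm)
    (Prod.ext_iff.1 h1).2.symm))

theorem IsStandard.below_lt {T : Tab n ν} (hT : IsStandard T) {i : Fin n} (hi : i ∈ topSet T) :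
    below T i < i := by
  have := hT.2 (T.symm (below T i)) (T.symm i) (by rw [symm_below])
    (by rw [symm_below, mem_topSet.1 hi]; exact one_pos)
  simpa using this

theorem spechtPoly_eq_prod_topSet (hν : ∀ c ∈ ν, c.1 ≤ 1) (T : Tab n ν) :
    spechtPoly T = ∏ i ∈ topSet T, (X i - X (below T i)) := by
  rw [spechtPoly, ← Finset.prod_filter]
  have hrow : ∀ p : ν.cells × ν.cells, p.1.1.2 = p.2.1.2 ∧ p.1.1.1 < p.2.1.1 →
      p.1.1.1 = 0 ∧ p.2.1.1 = 1 := by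
    rintro ⟨c, d⟩ hp
    have := hν d.1 d.2
    simp only at hp ⊢
    omega
  have hbelow : ∀ p : ν.cells × ν.cells, p.1.1.2 = p.2.1.2 ∧ p.1.1.1 < p.2.1.1 →
      below T (T p.2) = T p.1 := by
    intro p hp
    rw [below]
    congr 1
    refine Subtype.ext (Prod.ext (hrow p hp).1.symm ?_)
    simp [hp.1]
  refine Finset.prod_bij (fun p _ => T p.2) ?_ ?_ ?_ ?_
  · intro p hp
    exact apply_mem_topSet.2 (hrow p (Finset.mem_filter.1 hp).2).2
  · intro p hp q hq h
    have h1 := hbelow p (Finset.mem_filter.1 hp).2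
    have h2 := hbelow q (Finset.mem_filter.1 hq).2
    rw [h, h2] at h1
    exact Prod.ext (T.injective h1.symm) (T.injective h)
  · intro i hi
    refine ⟨(T.symm (below T i), T.symm i), Finset.mem_filter.2 ⟨Finset.mem_univ _, ?_⟩, by simp⟩
    rw [symm_below, mem_topSet.1 hi]
    exact ⟨rfl, one_pos⟩
  · intro p hp
    rw [hbelow p (Finset.mem_filter.1 hp).2]

theorem isHomogeneous_spechtPoly (hν : ∀ c ∈ ν, c.1 ≤ 1) (T : Tab n ν) :
    (spechtPoly T).IsHomogeneous (ν.rowLen 1) := by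
  rw [spechtPoly_eq_prod_topSet hν, ← card_topSet T, Finset.card_eq_sum_ones]
  exact IsHomogeneous.prod _ _ _ fun i _ =>
    (isHomogeneous_X ℚ i).sub (isHomogeneous_X ℚ (below T i))

/-- The derivation $\sum\partial_i$ kills every factor $x_i-x_j$. Distinct columns involve disjoint
pairs of variables, so the product is multilinear, and its degree is the length of the second row.
-/
theorem spechtPoly_mem_harmonicSubmodule {k : ℕ} (hν : ∀ c ∈ ν, c.1 ≤ 1) (hk : ν.rowLen 1 ≤ k)
    (T : Tab n ν) : spechtPoly T ∈ harmonicSubmodule n k := by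
  constructor
  · rw [spechtPoly_eq_prod_topSet hν]
    induction topSet T using Finset.induction_on with
    | empty => simp
    | insert a s ha ih =>
      simp only [Finset.prod_insert ha, pderiv_mul, Finset.sum_add_distrib]
      rw [← Finset.sum_mul, ← Finset.mul_sum, ih]
      simp [pderiv_X, Pi.single_apply]
  · intro m hm
    constructor
    · intro i
      refine (monomial_le_degreeOf i (mem_support_iff.2 hm)).trans ?_
      rw [spechtPoly_eq_prod_topSet hν]
      refine (degreeOf_prod_le i _ _).trans ?_
      have h1 : ∀ j ∈ topSet T, degreeOf i (X j - X (below T j) : MvPolynomial (Fin n) ℚ) ≤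
          if i = j ∨ i = below T j then 1 else 0 := by
        intro j _
        refine (degreeOf_sub_le _ _ _).trans ?_
        rw [degreeOf_X, degreeOf_X]
        split_ifs <;> simp_all
      refine (Finset.sum_le_sum h1).trans ?_
      rw [← Finset.card_filter, Finset.card_le_one]
      intro a ha b hb
      rw [Finset.mem_filter] at ha hb
      rcases ha.2 with rfl | ha'
      · rcases hb.2 with rfl | hb'
        · rfl
        · exact absurd (hb' ▸ ha.1) (below_notMem_topSet T b)
      · rcases hb.2 with rfl | hb'
        · exact absurd (ha' ▸ hb.1) (below_notMem_topSet T a)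
        · exact eq_of_below_eq ha.1 hb.1 (ha'.symm.trans hb')
    · have : m.degree = ν.rowLen 1 := by
        by_contra h
        exact hm ((isHomogeneous_spechtPoly hν T).coeff_eq_zero h)
      rw [Finsupp.degree_eq_sum] at this
      omega

/-! ### Linear independence -/

/-- In a vanishing combination, take the largest leading monomial among the terms with nonzero
coefficient. No other term contributes to it, so it cannot cancel. -/
theorem linearIndependent_of_monomialOrder_degree_injective {σ ι K : Type*} [Field K]
    (m : MonomialOrder σ) (v : ι → MvPolynomial σ K) (hv : ∀ i, v i ≠ 0)
    (hinj : Function.Injective fun i => m.degree (v i)) : LinearIndependent K v := by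
  classical
  rw [linearIndependent_iff']
  intro s g hg
  by_contra! hcon
  obtain ⟨i0, hi0, hgi0⟩ := hcon
  obtain ⟨i, hi, hmax⟩ := Finset.exists_max_image (s.filter fun i => g i ≠ 0)
    (fun i => m.toSyn (m.degree (v i))) ⟨i0, Finset.mem_filter.2 ⟨hi0, hgi0⟩⟩
  have hcoeff := congrArg (coeff (m.degree (v i))) hg
  rw [coeff_sum, coeff_zero, Finset.sum_eq_single i] at hcoeff
  · rw [coeff_smul, smul_eq_mul, mul_eq_zero] at hcoeff
    exact hcoeff.elim (Finset.mem_filter.1 hi).2 (m.coeff_degree_ne_zero_iff.2 (hv i))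
  · intro j hj hji
    rw [coeff_smul, smul_eq_mul, mul_eq_zero]
    by_cases hgj : g j = 0
    · exact Or.inl hgj
    · right
      refine m.coeff_eq_zero_of_lt (lt_of_le_of_ne (hmax j (Finset.mem_filter.2 ⟨hj, hgj⟩)) ?_)
      exact fun h => hji (hinj (m.toSyn.injective h))
  · exact fun h => absurd (Finset.mem_filter.1 hi).1 h

/-- The lexicographic order ranks variables of smaller index higher, so the indices are reversed to
make the upper, larger entry of each column lead its factor. -/
theorem rename_rev_spechtPoly_ne_zero_and_degree (hν : ∀ c ∈ ν, c.1 ≤ 1) {T : Tab n ν}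
    (hT : IsStandard T) : rename Fin.rev (spechtPoly T) ≠ 0 ∧
      MonomialOrder.lex.degree (rename Fin.rev (spechtPoly T)) =
        ∑ i ∈ topSet T, Finsupp.single (Fin.rev i) 1 := by
  rw [spechtPoly_eq_prod_topSet hν, map_prod]
  have hdeg : ∀ i ∈ topSet T, MonomialOrder.lex.degree
      (rename Fin.rev (X i - X (below T i) : MvPolynomial (Fin n) ℚ)) =
        Finsupp.single (Fin.rev i) 1 := by
    intro i hi
    rw [map_sub, rename_X, rename_X, MonomialOrder.degree_sub_of_lt, MonomialOrder.degree_X]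
    rw [MonomialOrder.degree_X, MonomialOrder.degree_X, MonomialOrder.lex_lt_iff,
      Finsupp.Lex.single_lt_iff, Fin.rev_lt_rev]
    exact hT.below_lt hi
  have hne : ∀ i ∈ topSet T,
      rename Fin.rev (X i - X (below T i) : MvPolynomial (Fin n) ℚ) ≠ 0 := by
    intro i hi h0
    have := hdeg i hi
    rw [h0, MonomialOrder.degree_zero] at this
    exact one_ne_zero (Finsupp.single_eq_zero.1 this.symm)
  exact ⟨Finset.prod_ne_zero_iff.2 hne, by
    rw [MonomialOrder.degree_prod hne, Finset.sum_congr rfl hdeg]⟩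

/-- Specht polynomials of standard tableaux with different second rows are linearly
independent. -/
theorem linearIndependent_spechtPoly {ι : Type*} (shape : ι → YoungDiagram)
    (hshape : ∀ q, ∀ c ∈ shape q, c.1 ≤ 1) (T : ∀ q, Tab n (shape q)) (hT : ∀ q, IsStandard (T q))
    (hinj : Function.Injective fun q => topSet (T q)) :
    LinearIndependent ℚ fun q => spechtPoly (T q) := by
  refine LinearIndependent.of_comp (rename Fin.rev).toLinearMap ?_
  refine linearIndependent_of_monomialOrder_degree_injective MonomialOrder.lex _
    (fun q => (rename_rev_spechtPoly_ne_zero_and_degree (hshape q) (hT q)).1) fun q q' h => ?_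
  refine hinj (Finset.ext fun i => ?_)
  have hdeg : ∀ q, MonomialOrder.lex.degree (rename Fin.rev (spechtPoly (T q))) (Fin.rev i) =
      if i ∈ topSet (T q) then 1 else 0 := by
    intro q
    rw [(rename_rev_spechtPoly_ne_zero_and_degree (hshape q) (hT q)).2, Finsupp.finsetSum_apply]
    simp [Finsupp.single_apply, Fin.rev_inj]
  have h' : MonomialOrder.lex.degree (rename Fin.rev (spechtPoly (T q))) (Fin.rev i) =
      MonomialOrder.lex.degree (rename Fin.rev (spechtPoly (T q'))) (Fin.rev i) :=
    DFunLike.congr_fun h _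
  rw [hdeg, hdeg] at h'
  split_ifs at h' <;> simp_all

end Specht

/-! ### Higher Specht polynomials of shapes with two rows -/

section HigherSpecht

/-- The permutations that preserve the sets `{i, b i}`, for `i ∈ s`, and fix all other elements. -/
def pairGroup {n : ℕ} (s : Finset (Fin n)) (b : Fin n → Fin n) : Finset (Equiv.Perm (Fin n)) :=
  Finset.univ.filter fun τ => ∀ x, τ x = x ∨ ∃ i ∈ s, (x = i ∧ τ x = b i) ∨ (x = b i ∧ τ x = i)

theorem mem_pairGroup {n : ℕ} {s : Finset (Fin n)} {b : Fin n → Fin n} {τ : Equiv.Perm (Fin n)} :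
    τ ∈ pairGroup s b ↔
      ∀ x, τ x = x ∨ ∃ i ∈ s, (x = i ∧ τ x = b i) ∨ (x = b i ∧ τ x = i) := by
  simp [pairGroup]

/-- The hypotheses make the pairs disjoint. A permutation in the larger group either fixes `a`, or
exchanges it with `b a`; in the second case, composing with the transposition gives an element of
the smaller group. -/
theorem pairGroup_insert {n : ℕ} {s : Finset (Fin n)} {b : Fin n → Fin n} {a : Fin n} (ha : a ∉ s)
    (hb : ∀ i ∈ insert a s, b i ∉ insert a s)
    (hinj : ∀ i ∈ insert a s, ∀ j ∈ insert a s, b i = b j → i = j) :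
    pairGroup (insert a s) b =
      pairGroup s b ∪ (pairGroup s b).image (Equiv.swap a (b a) * ·) := by
  have has : a ∈ insert a s := Finset.mem_insert_self a s
  have hs : ∀ i ∈ s, i ∈ insert a s := fun i hi => Finset.mem_insert_of_mem hi
  have h1 : ∀ i ∈ s, i ≠ a ∧ i ≠ b a ∧ b i ≠ a ∧ b i ≠ b a := fun i hi =>
    ⟨fun h => ha (h ▸ hi), fun h => hb a has (h ▸ hs i hi), fun h => hb i (hs i hi) (h ▸ has),
      fun h => ha (hinj i (hs i hi) a has h ▸ hi)⟩
  have h2 : b a ≠ a := fun h => hb a has (by rw [h]; exact has)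
  ext σ
  rw [Finset.mem_union, Finset.mem_image]
  constructor
  · intro hσ
    rw [mem_pairGroup] at hσ
    by_cases hσa : σ a = a
    · left
      rw [mem_pairGroup]
      intro x
      rcases hσ x with h | ⟨i, hi, h⟩
      · exact Or.inl h
      · rcases Finset.mem_insert.1 hi with rfl | hi
        · rcases h with ⟨rfl, h⟩ | ⟨rfl, h⟩
          · exact Or.inl hσa
          · exact absurd (σ.injective (h.trans hσa.symm)) h2
        · exact Or.inr ⟨i, hi, h⟩
    · right
      have hσab : σ a = b a := by
        rcases hσ a with h | ⟨i, hi, ⟨rfl, h⟩ | ⟨h, -⟩⟩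
        · exact absurd h hσa
        · exact h
        · exact absurd (h ▸ has) (hb i hi)
      refine ⟨Equiv.swap a (b a) * σ, ?_, by simp [← mul_assoc]⟩
      rw [mem_pairGroup]
      intro x
      rw [Equiv.Perm.mul_apply]
      by_cases hxa : x = a
      · left
        rw [hxa, hσab, Equiv.swap_apply_right]
      by_cases hxb : x = b a
      · left
        rw [hxb]
        rcases hσ (b a) with h | ⟨i, hi, ⟨h, -⟩ | ⟨h, h'⟩⟩
        · exact absurd (σ.injective (hσab.trans h.symm)) h2.symm
        · exact absurd (h ▸ hi) (hb a has)
        · rw [h', ← hinj a has i hi h, Equiv.swap_apply_left]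
      · rcases hσ x with h | ⟨i, hi, h⟩
        · left
          rw [h, Equiv.swap_apply_of_ne_of_ne hxa hxb]
        · rcases Finset.mem_insert.1 hi with rfl | hi
          · exact absurd h (by tauto)
          · right
            obtain ⟨hi1, hi2, hi3, hi4⟩ := h1 i hi
            refine ⟨i, hi, ?_⟩
            rcases h with ⟨hx, h⟩ | ⟨hx, h⟩
            · rw [h, Equiv.swap_apply_of_ne_of_ne hi3 hi4]
              exact Or.inl ⟨hx, rfl⟩
            · rw [h, Equiv.swap_apply_of_ne_of_ne hi1 hi2]
              exact Or.inr ⟨hx, rfl⟩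
  · rintro (hσ | ⟨τ, hτ, rfl⟩)
    · rw [mem_pairGroup] at hσ ⊢
      intro x
      rcases hσ x with h | ⟨i, hi, h⟩
      · exact Or.inl h
      · exact Or.inr ⟨i, hs i hi, h⟩
    · rw [mem_pairGroup] at hτ ⊢
      intro x
      rw [Equiv.Perm.mul_apply]
      rcases hτ x with h | ⟨i, hi, h⟩
      · rw [h]
        by_cases hxa : x = a
        · exact Or.inr ⟨a, has, Or.inl ⟨hxa, by rw [hxa, Equiv.swap_apply_left]⟩⟩
        by_cases hxb : x = b a
        · exact Or.inr ⟨a, has, Or.inr ⟨hxb, by rw [hxb, Equiv.swap_apply_right]⟩⟩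
        · exact Or.inl (Equiv.swap_apply_of_ne_of_ne hxa hxb)
      · right
        obtain ⟨hi1, hi2, hi3, hi4⟩ := h1 i hi
        refine ⟨i, hs i hi, ?_⟩
        rcases h with ⟨hx, h⟩ | ⟨hx, h⟩
        · rw [h, Equiv.swap_apply_of_ne_of_ne hi3 hi4]
          exact Or.inl ⟨hx, rfl⟩
        · rw [h, Equiv.swap_apply_of_ne_of_ne hi1 hi2]
          exact Or.inr ⟨hx, rfl⟩

/-- The antisymmetrization of `∏ i ∈ s, X i` over the permutations of the pairs `{i, b i}`. -/
theorem sum_pairGroup {n : ℕ} (s : Finset (Fin n)) (b : Fin n → Fin n)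
    (hb : ∀ i ∈ s, b i ∉ s) (hinj : ∀ i ∈ s, ∀ j ∈ s, b i = b j → i = j) :
    ∑ τ ∈ pairGroup s b, (((Equiv.Perm.sign τ : ℤˣ) : ℤ) : ℚ) •
      rename τ (∏ i ∈ s, X i : MvPolynomial (Fin n) ℚ) = ∏ i ∈ s, (X i - X (b i)) := by
  induction s using Finset.induction_on with
  | empty =>
    have : pairGroup ∅ b = {1} := by
      ext τ
      rw [mem_pairGroup, Finset.mem_singleton, Equiv.ext_iff]
      simp
    simp [this]
  | insert a s ha ih =>
    have has : a ∈ insert a s := Finset.mem_insert_self a s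
    have hs : ∀ i ∈ s, i ∈ insert a s := fun i hi => Finset.mem_insert_of_mem hi
    specialize ih (fun i hi h => hb i (hs i hi) (hs _ h))
      (fun i hi j hj => hinj i (hs i hi) j (hs j hj))
    have h2 : b a ≠ a := fun h => hb a has (by rw [h]; exact has)
    have hfix : ∀ τ ∈ pairGroup s b, τ a = a := by
      intro τ hτ
      rcases mem_pairGroup.1 hτ a with h | ⟨i, hi, ⟨rfl, -⟩ | ⟨h, -⟩⟩
      · exact h
      · exact absurd hi ha
      · exact absurd (h ▸ has) (hb i (hs i hi))
    have hdisj : Disjoint (pairGroup s b) ((pairGroup s b).image (Equiv.swap a (b a) * ·)) := by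
      rw [Finset.disjoint_left]
      intro σ hσ hσ'
      obtain ⟨τ, hτ, rfl⟩ := Finset.mem_image.1 hσ'
      have := hfix _ hσ
      rw [Equiv.Perm.mul_apply, hfix τ hτ, Equiv.swap_apply_left] at this
      exact h2 this
    have hsum : ∑ τ ∈ pairGroup s b, (((Equiv.Perm.sign τ : ℤˣ) : ℤ) : ℚ) •
        rename τ (∏ i ∈ insert a s, X i : MvPolynomial (Fin n) ℚ) =
          X a * ∏ i ∈ s, (X i - X (b i)) := by
      rw [← ih, Finset.mul_sum]
      refine Finset.sum_congr rfl fun τ hτ => ?_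
      rw [Finset.prod_insert ha, map_mul, rename_X, hfix τ hτ, mul_smul_comm]
    -- The nontrivial coset contributes the transposed sum with opposite sign. The transposition
    -- turns $x_a$ into $x_{b(a)}$ and fixes all other factors, which yields the new factor
    -- $x_a-x_{b(a)}$.
    have hswap : ∑ τ ∈ pairGroup s b,
        (((Equiv.Perm.sign (Equiv.swap a (b a) * τ) : ℤˣ) : ℤ) : ℚ) •
          rename (Equiv.swap a (b a) * τ : Equiv.Perm (Fin n))
            (∏ i ∈ insert a s, X i : MvPolynomial (Fin n) ℚ) =
          -rename (Equiv.swap a (b a)) (X a * ∏ i ∈ s, (X i - X (b i)) :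
            MvPolynomial (Fin n) ℚ) := by
      rw [← hsum, map_sum, ← Finset.sum_neg_distrib]
      refine Finset.sum_congr rfl fun τ hτ => ?_
      rw [Equiv.Perm.sign_mul, Equiv.Perm.sign_swap h2.symm, map_smul, rename_rename,
        Equiv.Perm.coe_mul]
      simp
    rw [pairGroup_insert ha hb hinj, Finset.sum_union hdisj,
      Finset.sum_image fun _ _ _ _ h => mul_left_cancel h, hsum, hswap, map_mul, map_prod, rename_X,
      Equiv.swap_apply_left, Finset.prod_insert ha, sub_mul, sub_eq_add_neg]
    congr 3
    refine Finset.prod_congr rfl fun i hi => ?_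
    rw [map_sub, rename_X, rename_X, Equiv.swap_apply_of_ne_of_ne, Equiv.swap_apply_of_ne_of_ne]
    · exact fun h => hb i (hs i hi) (h ▸ has)
    · exact fun h => ha (hinj i (hs i hi) a has h ▸ hi)
    · exact fun h => ha (h ▸ hi)
    · exact fun h => hb a has (h ▸ hs i hi)

variable {n : ℕ} {ν : YoungDiagram}

/-- Columns have at most two squares, so an entry moved within its column is exchanged with the only
other entry there. -/
theorem colGroup_eq_pairGroup (hν : ∀ c ∈ ν, c.1 ≤ 1) (T : Tab n ν) :
    colGroup T = pairGroup (topSet T) (below T) := by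
  ext τ
  rw [mem_pairGroup, colGroup, Finset.mem_filter]
  constructor
  · rintro ⟨-, h⟩ x
    have hx := hν _ (T.symm x).2
    have hy := hν _ (T.symm (τ x)).2
    have hb : ∀ i j : Fin n, (T.symm i).1.1 = 0 → (T.symm i).1.2 = (T.symm j).1.2 →
        i = below T j := by
      intro i j h0 hij
      refine T.symm.injective (Subtype.ext ?_)
      rw [symm_below]
      exact Prod.ext h0 hij
    by_cases heq : (T.symm (τ x)).1.1 = (T.symm x).1.1
    · exact Or.inl (T.symm.injective (Subtype.ext (Prod.ext heq (h x))))
    · right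
      by_cases h1 : (T.symm x).1.1 = 1
      · exact ⟨x, mem_topSet.2 h1, Or.inl ⟨rfl, hb _ _ (by omega) (h x)⟩⟩
      · exact ⟨τ x, mem_topSet.2 (by omega), Or.inr ⟨hb _ _ (by omega) (h x).symm, rfl⟩⟩
  · intro h
    refine ⟨Finset.mem_univ _, fun x => ?_⟩
    rcases h x with h | ⟨i, -, ⟨rfl, h⟩ | ⟨h, h'⟩⟩
    · rw [h]
    · rw [h, symm_below]
    · rw [h', h, symm_below]

theorem prod_X_pow_row (hν : ∀ c ∈ ν, c.1 ≤ 1) (T : Tab n ν) :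
    (∏ c : ν.cells, X (T c) ^ c.1.1 : MvPolynomial (Fin n) ℚ) = ∏ i ∈ topSet T, X i := by
  rw [topSet, Finset.prod_filter, ← Equiv.prod_comp T]
  refine Finset.prod_congr rfl fun c _ => ?_
  have := hν c.1 c.2
  rw [Equiv.symm_apply_apply]
  obtain h | h : c.1.1 = 0 ∨ c.1.1 = 1 := by omega
  · simp [h]
  · simp [h]

theorem rename_prod_topSet {T : Tab n ν} {σ : Equiv.Perm (Fin n)} (hσ : σ ∈ rowGroup T) :
    rename σ (∏ i ∈ topSet T, X i : MvPolynomial (Fin n) ℚ) = ∏ i ∈ topSet T, X i := by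
  rw [rowGroup, Finset.mem_filter] at hσ
  rw [map_prod]
  simp only [rename_X]
  refine Finset.prod_equiv σ (fun i => ?_) fun _ _ => rfl
  rw [mem_topSet, mem_topSet, hσ.2 i]

/-- For a tableau `S` with content `(n - k, k)`, the polynomial `F_T^S` is a multiple of the
Specht polynomial of `T`. -/
theorem higherSpecht_eq {k : ℕ} {hk : 2 * k ≤ n} {S : SemistandardYoungTableau ν}
    (hS : HasContent S (twoRow n k hk)) (T : Tab n ν) :
    higherSpecht S T = ((rowGroup T).card : ℚ) • spechtPoly T := by
  have hν : ∀ c ∈ ν, c.1 ≤ 1 := fun c hc => hS.row_le_one (i := c.1) (j := c.2) hc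
  have hM : (∏ c : ν.cells, X (T c) ^ cwTableau S c.1 : MvPolynomial (Fin n) ℚ) =
      ∏ i ∈ topSet T, X i := by
    rw [← prod_X_pow_row hν]
    exact Finset.prod_congr rfl fun c _ => by rw [hS.cwTableau_eq c.2]
  -- Row permutations fix the product of the second-row variables, so the inner sum contributes only
  -- the factor $|R(T)|$.
  have hterm : ∀ τ, ∀ σ ∈ rowGroup T, polyRep n (τ * σ) (∏ i ∈ topSet T, X i) =
      rename τ (∏ i ∈ topSet T, X i : MvPolynomial (Fin n) ℚ) := by
    intro τ σ hσ
    rw [map_mul, Module.End.mul_apply]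
    change rename τ (rename σ _) = _
    rw [rename_prod_topSet hσ]
  rw [higherSpecht, hM, youngSymmetrizer, map_sum, LinearMap.sum_apply,
    spechtPoly_eq_prod_topSet hν, ← sum_pairGroup _ _ (fun i _ => below_notMem_topSet T i)
      (fun i hi j hj => eq_of_below_eq hi hj), ← colGroup_eq_pairGroup hν, Finset.smul_sum]
  refine Finset.sum_congr rfl fun τ _ => ?_
  rw [map_sum, LinearMap.sum_apply]
  have : ∀ σ ∈ rowGroup T, (polyRep n).asAlgebraHom (MonoidAlgebra.single (τ * σ)
      (((Equiv.Perm.sign τ : ℤˣ) : ℤ) : ℚ)) (∏ i ∈ topSet T, X i) =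
      (((Equiv.Perm.sign τ : ℤˣ) : ℤ) : ℚ) •
        rename τ (∏ i ∈ topSet T, X i : MvPolynomial (Fin n) ℚ) := by
    intro σ hσ
    rw [Representation.asAlgebraHom_single, LinearMap.smul_apply, hterm τ σ hσ]
  rw [Finset.sum_congr rfl this, Finset.sum_const, Nat.cast_smul_eq_nsmul]

theorem card_rowGroup_ne_zero (T : Tab n ν) : ((rowGroup T).card : ℚ) ≠ 0 := by
  rw [Nat.cast_ne_zero, Finset.card_ne_zero]
  exact ⟨1, by simp [rowGroup]⟩

end HigherSpecht

/-! ### The higher Specht basis -/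

section Basis

variable {n k : ℕ} {hk : 2 * k ≤ n}

theorem TableauPair.row_le_one (q : TableauPair n (twoRow n k hk)) : ∀ c ∈ q.1.1, c.1 ≤ 1 :=
  fun c hc => q.2.1.2.row_le_one (i := c.1) (j := c.2) hc

theorem TableauPair.eq_of_rowLen_one_eq (q : TableauPair n (twoRow n k hk)) {ν : Shape n}
    (hν : ∀ c ∈ ν.1, c.1 ≤ 1) (h : q.1.1.rowLen 1 = ν.1.rowLen 1) : q.1 = ν :=
  Subtype.ext (_root_.eq_of_rowLen_one_eq q.row_le_one hν (q.1.2.trans ν.2.symm) h)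

/-- The size of the second row recovers the shape, the shape determines $S$, and the second row
itself determines $T$. -/
theorem injective_topSet :
    Function.Injective fun q : TableauPair n (twoRow n k hk) => topSet q.2.2.1 := by
  intro q q' h
  simp only at h
  have hν : q.1 = q'.1 := q.eq_of_rowLen_one_eq q'.row_le_one (by
    rw [← card_topSet q.2.2.1, ← card_topSet q'.2.2.1, h])
  have hrow := q.row_le_one
  obtain ⟨ν, ⟨S, hS⟩, ⟨T, hT⟩⟩ := q
  obtain ⟨ν', ⟨S', hS'⟩, ⟨T', hT'⟩⟩ := q'
  obtain rfl : ν = ν' := hν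
  obtain rfl : S = S' := hS.eq hS'
  obtain rfl : T = T' := hT.eq_of_topSet_eq hrow hT' h
  rfl

theorem exists_topSet_eq {A : Finset (Fin n)} (hA : IsBallot A) (hAk : A.card ≤ k) :
    ∃ q : TableauPair n (twoRow n k hk), topSet q.2.2.1 = A := by
  have h : 2 * A.card ≤ n := by omega
  obtain ⟨T, hT, hTA⟩ := hA.exists_isStandard h
  obtain ⟨S, hS⟩ := exists_hasContent (hk := hk) hAk h
  exact ⟨⟨⟨_, card_twoRow h⟩, ⟨S, hS⟩, ⟨T, hT⟩⟩, hTA⟩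

/-- The polynomial `F_T^S` of a pair `(S, T)`. -/
def pairPoly (q : TableauPair n (twoRow n k hk)) : MvPolynomial (Fin n) ℚ :=
  higherSpecht q.2.1.1 q.2.2.1

theorem pairPoly_eq (q : TableauPair n (twoRow n k hk)) :
    pairPoly q = ((rowGroup q.2.2.1).card : ℚ) • spechtPoly q.2.2.1 :=
  higherSpecht_eq q.2.1.2 _

theorem linearIndependent_pairPoly :
    LinearIndependent ℚ (pairPoly : TableauPair n (twoRow n k hk) → _) := by
  have h := (linearIndependent_spechtPoly (fun q : TableauPair n (twoRow n k hk) => q.1.1)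
    (fun q => q.row_le_one) (fun q => q.2.2.1) (fun q => q.2.2.2) injective_topSet).units_smul
    fun q => Units.mk0 _ (card_rowGroup_ne_zero q.2.2.1)
  convert h using 1
  ext1 q
  exact pairPoly_eq q

theorem pairPoly_mem_harmonicSubmodule (q : TableauPair n (twoRow n k hk)) :
    pairPoly q ∈ harmonicSubmodule n k := by
  rw [pairPoly_eq]
  exact Submodule.smul_mem _ _
    (spechtPoly_mem_harmonicSubmodule q.row_le_one q.2.1.2.rowLen_one_le _)

theorem pairPoly_mem_homogeneousSubmodule (q : TableauPair n (twoRow n k hk)) :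
    pairPoly q ∈ homogeneousSubmodule (Fin n) ℚ (q.1.1.rowLen 1) := by
  rw [pairPoly_eq]
  exact Submodule.smul_mem _ _ (isHomogeneous_spechtPoly q.row_le_one _)

theorem span_pairPoly_le :
    Submodule.span ℚ (Set.range (pairPoly : TableauPair n (twoRow n k hk) → _)) ≤
      harmonicSubmodule n k := by
  rw [Submodule.span_le]
  rintro _ ⟨q, rfl⟩
  exact pairPoly_mem_harmonicSubmodule q

/-- The quotient map onto `R_μ` as a linear map. -/
def toGarsiaProcesi (n : ℕ) (μ : YoungDiagram) : MvPolynomial (Fin n) ℚ →ₗ[ℚ] GarsiaProcesi n μ :=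
  (Ideal.Quotient.mkₐ ℚ (tanisakiIdeal n μ)).toLinearMap

theorem toGarsiaProcesi_apply (μ : YoungDiagram) (p : MvPolynomial (Fin n) ℚ) :
    toGarsiaProcesi n μ p = Ideal.Quotient.mk (tanisakiIdeal n μ) p := rfl

theorem higherSpechtClass_eq (q : TableauPair n (twoRow n k hk)) :
    higherSpechtClass n (twoRow n k hk) q = toGarsiaProcesi n (twoRow n k hk) (pairPoly q) := rfl

theorem disjoint_harmonicSubmodule_ker :
    Disjoint (harmonicSubmodule n k) (LinearMap.ker (toGarsiaProcesi n (twoRow n k hk))) := by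
  rw [Submodule.disjoint_def]
  intro p hp hp'
  rw [LinearMap.mem_ker, toGarsiaProcesi_apply, Ideal.Quotient.eq_zero_iff_mem] at hp'
  exact eq_zero_of_mem_harmonic_of_mem_tanisakiIdeal hk hp hp'

/-- The span lies in the harmonic space, on which the quotient map is injective. -/
theorem linearIndependent_higherSpechtClass :
    LinearIndependent ℚ (higherSpechtClass n (twoRow n k hk)) :=
  linearIndependent_pairPoly.map (disjoint_harmonicSubmodule_ker.mono_left span_pairPoly_le)

/-- With $D$ the ballot sets of size at most $k$, straightening gives $\dim R_\mu\le|D|$. Choosing a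
pair for each ballot set bounds $|D|$ by the number of pairs, and independence bounds that number by
$\dim R_\mu$. -/
theorem span_higherSpechtClass :
    Submodule.span ℚ (Set.range (higherSpechtClass n (twoRow n k hk))) = ⊤ := by
  classical
  set D := {A : Finset (Fin n) // IsBallot A ∧ A.card ≤ k} with hD
  have : Fintype D := Fintype.ofFinite D
  set b : D → GarsiaProcesi n (twoRow n k hk) := fun A =>
    Ideal.Quotient.mk (tanisakiIdeal n (twoRow n k hk)) (∏ i ∈ A.1, X i) with hb
  have htop : Submodule.span ℚ (Set.range b) = ⊤ :=
    eq_top_of_isBallot_mem hk _ fun A hA hAk => Submodule.subset_span ⟨⟨A, hA, hAk⟩, rfl⟩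
  have hfin : Module.Finite ℚ (GarsiaProcesi n (twoRow n k hk)) :=
    ⟨htop ▸ Submodule.fg_span (Set.finite_range b)⟩
  have hle : Module.finrank ℚ (GarsiaProcesi n (twoRow n k hk)) ≤ Fintype.card D := by
    rw [← finrank_top ℚ (GarsiaProcesi n (twoRow n k hk)), ← htop]
    exact finrank_range_le_card b
  have hli := linearIndependent_higherSpechtClass (hk := hk)
  have : Finite (TableauPair n (twoRow n k hk)) :=
    Finite.of_injective _ (injective_topSet (hk := hk))
  have : Fintype (TableauPair n (twoRow n k hk)) := Fintype.ofFinite _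
  choose f hf using fun A : D => exists_topSet_eq (hk := hk) A.2.1 A.2.2
  have hfinj : Function.Injective f := fun A B h => Subtype.ext (by rw [← hf A, h, hf B])
  have hcard := Fintype.card_le_of_injective f hfinj
  exact hli.span_eq_top_of_card_eq_finrank'
    (le_antisymm hli.fintype_card_le_finrank (hle.trans hcard))

/-- The image of the Specht module of `ν` in `R_μ` is spanned by the classes of the higher Specht
polynomials of the pairs of shape `ν`. -/
theorem map_spechtModule (ν : Shape n) (hν : Nonempty (SSYT ν.1 (twoRow n k hk))) :
    (spechtModule n ν.1).toSubmodule.map (toGarsiaProcesi n (twoRow n k hk)) =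
      Submodule.span ℚ (higherSpechtClass n (twoRow n k hk) '' {q | q.1 = ν}) := by
  obtain ⟨S, hS⟩ := hν
  have hrow : ∀ c ∈ ν.1, c.1 ≤ 1 := fun c hc => hS.row_le_one (i := c.1) (j := c.2) hc
  apply le_antisymm
  · rw [Submodule.map_le_iff_le_comap]
    refine Submodule.span_le.2 ?_
    rintro _ ⟨T, rfl⟩
    have hT : spechtPoly T ∈ harmonicSubmodule n k :=
      spechtPoly_mem_harmonicSubmodule hrow hS.rowLen_one_le T
    -- The class of the polynomial lies in the span of the classes. A lift from the span and the
    -- polynomial itself are both harmonic with equal class, hence equal. Thus the relation already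
    -- holds among polynomials, where degree can be used.
    have hspan : spechtPoly T ∈
        Submodule.span ℚ (Set.range (pairPoly : TableauPair n (twoRow n k hk) → _)) := by
      have h1 : toGarsiaProcesi n (twoRow n k hk) (spechtPoly T) ∈
          Submodule.span ℚ (Set.range (higherSpechtClass n (twoRow n k hk))) := by
        rw [span_higherSpechtClass]
        exact Submodule.mem_top
      have h2 : Set.range (higherSpechtClass n (twoRow n k hk)) =
          toGarsiaProcesi n (twoRow n k hk) ''
            Set.range (pairPoly : TableauPair n (twoRow n k hk) → _) := by
        rw [← Set.range_comp]
        rfl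
      rw [h2, ← Submodule.map_span] at h1
      obtain ⟨g, hg, hgT⟩ := h1
      have := (Submodule.disjoint_def.1 (disjoint_harmonicSubmodule_ker (hk := hk)))
        (g - spechtPoly T) (Submodule.sub_mem _ (span_pairPoly_le hg) hT)
        (by rw [LinearMap.mem_ker, map_sub, hgT, sub_self])
      rwa [← sub_eq_zero.1 this]
    have hcomp : homogeneousComponent (ν.1.rowLen 1) (spechtPoly T) = spechtPoly T := by
      rw [homogeneousComponent_of_mem (isHomogeneous_spechtPoly hrow T), if_pos rfl]
    have h3 := Submodule.mem_map_of_mem (f := homogeneousComponent (ν.1.rowLen 1)) hspan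
    rw [hcomp, Submodule.map_span] at h3
    -- Taking the component of degree `ν.1.rowLen 1` discards all other shapes, since the length of
    -- the second row determines the shape.
    have hle : Submodule.span ℚ (homogeneousComponent (ν.1.rowLen 1) ''
        Set.range (pairPoly : TableauPair n (twoRow n k hk) → _)) ≤
        Submodule.span ℚ (pairPoly '' {q : TableauPair n (twoRow n k hk) | q.1 = ν}) := by
      rw [Submodule.span_le]
      rintro _ ⟨_, ⟨q, rfl⟩, rfl⟩
      rw [homogeneousComponent_of_mem (pairPoly_mem_homogeneousSubmodule q)]
      split_ifs with h
      · exact Submodule.subset_span ⟨q, q.eq_of_rowLen_one_eq hrow h.symm, rfl⟩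
      · exact Submodule.zero_mem _
    have h4 := Submodule.mem_map_of_mem (f := toGarsiaProcesi n (twoRow n k hk)) (hle h3)
    rw [Submodule.map_span, ← Set.image_comp] at h4
    exact h4
  · rw [Submodule.span_le]
    rintro _ ⟨q, rfl, rfl⟩
    rw [higherSpechtClass_eq, pairPoly_eq]
    exact Submodule.mem_map_of_mem (Submodule.smul_mem _ _ (Submodule.subset_span ⟨_, rfl⟩))

/-- The image of the Specht module of `ν` in `R_μ`. -/
def spechtImage (n : ℕ) (μ ν : YoungDiagram) : Subrepresentation (garsiaProcesiRep n μ) where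
  toSubmodule := (spechtModule n ν).toSubmodule.map (toGarsiaProcesi n μ)
  apply_mem_toSubmodule σ v hv := by
    obtain ⟨p, hp, rfl⟩ := hv
    exact ⟨polyRep n σ p, (spechtModule n ν).apply_mem_toSubmodule σ hp, rfl⟩

theorem spechtModule_le_harmonicSubmodule {ν : YoungDiagram}
    (hν : Nonempty (SSYT ν (twoRow n k hk))) :
    (spechtModule n ν).toSubmodule ≤ harmonicSubmodule n k := by
  obtain ⟨S, hS⟩ := hν
  refine Submodule.span_le.2 ?_
  rintro _ ⟨T, rfl⟩
  exact spechtPoly_mem_harmonicSubmodule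
    (fun c hc => hS.row_le_one (i := c.1) (j := c.2) hc) hS.rowLen_one_le T

/-- The Specht module is harmonic, so the quotient map restricts to an isomorphism onto its image.
-/
theorem nonempty_equiv_spechtImage {ν : YoungDiagram} (hν : Nonempty (SSYT ν (twoRow n k hk))) :
    Nonempty ((spechtImage n (twoRow n k hk) ν).toRepresentation.Equiv
      (spechtModule n ν).toRepresentation) := by
  set f := (toGarsiaProcesi n (twoRow n k hk)).restrict
    (p := (spechtModule n ν).toSubmodule)
    (q := (spechtImage n (twoRow n k hk) ν).toSubmodule)
    (fun p hp => Submodule.mem_map_of_mem hp) with hf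
  have hbij : Function.Bijective f := by
    constructor
    · rw [← LinearMap.ker_eq_bot, LinearMap.ker_eq_bot']
      intro p hp
      refine Subtype.ext ((Submodule.disjoint_def.1 (disjoint_harmonicSubmodule_ker (hk := hk)))
        p.1 (spechtModule_le_harmonicSubmodule hν p.2) ?_)
      exact congrArg Subtype.val hp
    · rintro ⟨_, p, hp, rfl⟩
      exact ⟨⟨p, hp⟩, rfl⟩
  exact ⟨(Representation.Equiv.mk (LinearEquiv.ofBijective f hbij) fun σ => rfl).symm⟩

theorem isHigherSpechtBasis_range_higherSpechtClass :
    IsHigherSpechtBasis (garsiaProcesiRep n (twoRow n k hk))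
      (Set.range (higherSpechtClass n (twoRow n k hk))) := by
  classical
  have hli := linearIndependent_higherSpechtClass (hk := hk)
  set v := higherSpechtClass n (twoRow n k hk) with hv
  -- The multiplicity is one or zero because there is at most one $S$ of each shape. The summands
  -- are spans of disjoint parts of one basis, which makes their sum direct.
  set c : Shape n → ℕ := fun ν => if Nonempty (SSYT ν.1 (twoRow n k hk)) then 1 else 0 with hc
  have hne : ∀ i : Σ ν : Shape n, Fin (c ν), Nonempty (SSYT i.1.1 (twoRow n k hk)) := by
    rintro ⟨ν, i⟩
    by_contra h
    have : c ν = 0 := if_neg h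
    exact absurd i.2 (by omega)
  have hext : ∀ i j : Σ ν : Shape n, Fin (c ν), i.1 = j.1 → i = j := by
    rintro ⟨ν, i⟩ ⟨ν', j⟩ h
    obtain rfl : ν = ν' := h
    have : c ν ≤ 1 := by
      rw [hc]
      simp only
      split_ifs <;> omega
    exact congrArg _ (Fin.ext (by omega))
  have hidx : ∀ q : TableauPair n (twoRow n k hk), ∃ i : Σ ν : Shape n, Fin (c ν), i.1 = q.1 := by
    intro q
    have : c q.1 = 1 := if_pos ⟨q.2.1⟩
    exact ⟨⟨q.1, ⟨0, by omega⟩⟩, rfl⟩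
  have hspan : ∀ i : Σ ν : Shape n, Fin (c ν),
      (spechtImage n (twoRow n k hk) i.1.1).toSubmodule =
        Submodule.span ℚ (v '' {q | q.1 = i.1}) := fun i => map_spechtModule i.1 (hne i)
  have hunion : Set.range v = ⋃ i : Σ ν : Shape n, Fin (c ν), v '' {q | q.1 = i.1} := by
    ext x
    rw [Set.mem_iUnion]
    constructor
    · rintro ⟨q, rfl⟩
      obtain ⟨i, hi⟩ := hidx q
      exact ⟨i, q, hi.symm, rfl⟩
    · rintro ⟨i, q, -, rfl⟩
      exact ⟨q, rfl⟩
  refine ⟨c, fun i => spechtImage n (twoRow n k hk) i.1.1, fun i => v '' {q | q.1 = i.1},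
    ?_, ?_, fun i => nonempty_equiv_spechtImage (hne i), hunion, fun i => ⟨?_, (hspan i).symm⟩⟩
  · intro i
    simp only [hspan]
    refine (hli.disjoint_span_image (s := {q | q.1 = i.1}) (t := {q | q.1 ≠ i.1}) ?_).mono_right ?_
    · rw [Set.disjoint_left]
      exact fun q hq hq' => hq' hq
    · refine iSup₂_le fun j hj => Submodule.span_mono (Set.image_mono fun q hq h => hj ?_)
      exact hext j i (hq.symm.trans h)
  · simp only [hspan]
    rw [← Submodule.span_iUnion, ← hunion]
    exact span_higherSpechtClass
  · exact (hli.linearIndepOn _).id_image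

end Basis

end

theorem mainTheorem2 (n k : ℕ) (hk : 2 * k ≤ n) :
    Function.Injective (higherSpechtClass n (twoRow n k hk)) ∧
      IsHigherSpechtBasis (garsiaProcesiRep n (twoRow n k hk))
        (Set.range (higherSpechtClass n (twoRow n k hk))) :=
  ⟨linearIndependent_higherSpechtClass.injective, isHigherSpechtBasis_range_higherSpechtClass⟩
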